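/- **Conventions.** A *flow* $(T_t)_{t\in\mathbb R}$ on a standard Borel probability space $(X,\mathscr B,\mu)$ is a jointly measurable, $\mu$-preserving action of $\mathbb R$ on $X$. It is *weakly mixing* if the flow $(T_t\times T_t)_{t\in\mathbb R}$ is ergodic for $\mu\otimes\mu$. Let $d$ be a complete metric on $X$ whose Borel $\sigma$-algebra is $\mathscr B$. The flow is *almost continuous* if for every $\epsilon>0$ there is $X(\epsilon)\in\mathscr B$ with $\mu(X(\epsilon))>1-\epsilon$ such that for every $\epsilon'>0$ there is $\delta'>0$ with $d(T_tx,T_{t'}x)<\epsilon'$ for all $x\in X(\epsilon)$ and $t,t'\in[-\delta',\delta']$. For $t_0>0$ and a compact $P\subset\mathbb R\setminus\{0\}$, the flow has the *switchable $R(t_0,P)$-property* if for every $\epsilon>0$ there is $\kappa=\kappa(\epsilon)>0$ such that for every $N\in\mathbb N$ there are $\delta=\delta(\epsilon,N)>0$ and $Z=Z(\epsilon,N)\in\mathscr B$ with $\mu(Z)>1-\epsilon$ such that for all $x,y\in Z$ with $d(x,y)<\delta$ and $x$ not in the orbit of $y$ there exist $M,L\in\mathbb N$ with $M,L>N$, $L/M\ge\kappa$,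 and $p\in P$ for which $$\frac1L\,\big|\{n\in[M,M+L]\cap\mathbb Z:\ d(T_{nt_0}x,T_{nt_0+p}\,y)<\epsilon\}\big|>1-\epsilon$$ or $$\frac1L\,\big|\{n\in[M,M+L]\cap\mathbb Z:\ d(T_{-nt_0}x,T_{-nt_0+p}\,y)<\epsilon\}\big|>1-\epsilon .$$ The flow has the *SWR-property* if for some compact $P\subset\mathbb R\setminus\{0\}$ the set of $t_0>0$ for which it has the switchable $R(t_0,P)$-property is uncountable. An *ergodic joining* of $(T_t)$ with a flow $(S_t)_{t\in\mathbb R}$ on $(Y,\mathscr C,\nu)$ is a measure $\rho$ on $X\times Y$ with marginals $\mu$ and $\nu$ that is invariant and ergodic under $(T_t\times S_t)_{t\in\mathbb R}$. It is a *finite extension of $\nu$* if there are an integer $k\ge1$ and a measurable $E\subset X\times Y$ of full $\rho$-measure such that, for $\nu$-almost every $y$, the fibre $\{x\in X:(x,y)\in E\}$ has exactly $k$ points. **Theorem.** Let $(X,\mathscr B,\mu)$ be a standard Borel probability space and $d$ a complete metric on $X$ whose Borel $\sigma$-algebra is $\mathscr B$. Let $(T_t)_{t\in\mathbb R}$ be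 a weakly mixing, almost continuous flow on $(X,\mathscr B,\mu)$ with the SWR-property. Then $(T_t)$ has the finite extension joining property, that is: for every ergodic flow $(S_t)_{t\in\mathbb R}$ on a standard Borel probability space $(Y,\mathscr C,\nu)$ and every ergodic joining $\rho$ of $(T_t)$ and $(S_t)$, either $\rho=\mu\otimes\nu$ or $\rho$ is a finite extension of $\nu$. -/

import Mathlib

open MeasureTheory

/- A measurable flow `(T_t)` on `X` is a jointly measurable additive action of `ℝ`
(`[AddAction ℝ X] [MeasurableVAdd₂ ℝ X]`), with `T_t x = t +ᵥ x`; that it preserves `μ` is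
`VAddInvariantMeasure ℝ X μ`, that it is ergodic is `ErgodicVAdd ℝ X μ` (which includes
invariance). On `X × Y` the action is the diagonal one, `t +ᵥ (x, y) = (t +ᵥ x, t +ᵥ y)`. -/

/-- The measure preserving flow on `(X, μ)` is weakly mixing: its Cartesian square is ergodic. -/
def IsWeaklyMixingFlow {X : Type*} [MeasurableSpace X] [AddAction ℝ X] (μ : Measure X) : Prop :=
  VAddInvariantMeasure ℝ X μ ∧ ErgodicVAdd ℝ (X × X) (μ.prod μ)

/-- The flow is almost continuous: on sets of measure arbitrarily close to `1`, the orbit maps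
`t ↦ T_t x` are uniformly continuous at time `0`. -/
def IsAlmostContinuousFlow {X : Type*} [MetricSpace X] [MeasurableSpace X] [AddAction ℝ X]
    (μ : Measure X) : Prop :=
  ∀ ε : ℝ, 0 < ε → ∃ A : Set X, MeasurableSet A ∧ 1 - ε < μ.real A ∧
    ∀ ε' : ℝ, 0 < ε' → ∃ δ' : ℝ, 0 < δ' ∧ ∀ x ∈ A,
      ∀ t ∈ Set.Icc (-δ') δ', ∀ t' ∈ Set.Icc (-δ') δ', dist (t +ᵥ x) (t' +ᵥ x) < ε'

open Classical in
/-- The proportion `(1 / L) * |{n ∈ [M, M + L] : d(T_{n s} x, T_{n s + p} y) < ε}|`. -/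
noncomputable def shiftedCloseness {X : Type*} [MetricSpace X] [AddAction ℝ X]
    (s p ε : ℝ) (x y : X) (M L : ℕ) : ℝ :=
  (1 / (L : ℝ)) *
    (((Finset.Icc M (M + L)).filter fun n : ℕ =>
      dist (((n : ℝ) * s) +ᵥ x) (((n : ℝ) * s + p) +ᵥ y) < ε).card : ℝ)

/-- The switchable `R(t₀, P)`-property. -/
def HasSwitchableR {X : Type*} [MetricSpace X] [MeasurableSpace X] [AddAction ℝ X]
    (μ : Measure X) (t₀ : ℝ) (P : Set ℝ) : Prop :=
  ∀ ε : ℝ, 0 < ε → ∃ κ : ℝ, 0 < κ ∧ ∀ N : ℕ, ∃ δ : ℝ, 0 < δ ∧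
    ∃ Z : Set X, MeasurableSet Z ∧ 1 - ε < μ.real Z ∧
      ∀ x ∈ Z, ∀ y ∈ Z, dist x y < δ → x ∉ AddAction.orbit ℝ y →
        ∃ M L : ℕ, N < M ∧ N < L ∧ κ ≤ (L : ℝ) / (M : ℝ) ∧ ∃ p ∈ P,
          1 - ε < shiftedCloseness t₀ p ε x y M L ∨
          1 - ε < shiftedCloseness (-t₀) p ε x y M L

/-- The SWR-property (switchable weak Ratner property): for some compact `P ⊆ ℝ \ {0}`, the set of
`t₀ > 0` for which the switchable `R(t₀, P)`-property holds is uncountable. -/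
def HasSWR {X : Type*} [MetricSpace X] [MeasurableSpace X] [AddAction ℝ X]
    (μ : Measure X) : Prop :=
  ∃ P : Set ℝ, IsCompact P ∧ (0 : ℝ) ∉ P ∧ ¬ {t₀ : ℝ | 0 < t₀ ∧ HasSwitchableR μ t₀ P}.Countable

/-- `ρ` is an ergodic joining of the flows on `(X, μ)` and `(Y, ν)`: a measure on `X × Y` with
marginals `μ` and `ν`, invariant and ergodic under the diagonal flow. -/
structure IsErgodicJoining {X Y : Type*} [MeasurableSpace X] [MeasurableSpace Y]
    [AddAction ℝ X] [AddAction ℝ Y] (μ : Measure X) (ν : Measure Y) (ρ : Measure (X × Y)) :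
    Prop where
  map_fst : ρ.map Prod.fst = μ
  map_snd : ρ.map Prod.snd = ν
  ergodic : ErgodicVAdd ℝ (X × Y) ρ

/-- `ρ` is a finite extension of `ν`: up to `ρ`-null sets, the projection `(X × Y, ρ) → (Y, ν)` is
`k`-to-one for some positive integer `k`. -/
def IsFiniteExtension {X Y : Type*} [MeasurableSpace X] [MeasurableSpace Y]
    (ν : Measure Y) (ρ : Measure (X × Y)) : Prop :=
  ∃ k : ℕ, 0 < k ∧ ∃ E : Set (X × Y), MeasurableSet E ∧ ρ Eᶜ = 0 ∧
    ∀ᵐ y ∂ν, {x : X | (x, y) ∈ E}.encard = k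

section Preliminaries

open Set Filter Topology
open scoped symmDiff ENNReal NNReal ProbabilityTheory

/-! ### Continuity and averages of correlation functions -/

section FlowContinuity

/-! Let `ρ` be an ergodic joining other than the product. The aim is a set of positive `ρ`-measure
with countable fibres over `Y`; finiteness of the extension then follows from ergodicity alone.

Weak mixing makes every `T_p` with `p ≠ 0` ergodic (`IsWeaklyMixingFlow.ergodic_vadd`). Hence `ρ` is
not invariant under `T_p × id`: otherwise each measure `A ↦ ρ (A ×ˢ B)` would be `T_p`-invariant and
absolutely continuous with respect to `μ`, so a multiple of `μ`, and `ρ` would be the product. Some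
test function `1_B(y) φ(x)` therefore changes its integral by a definite amount when `x` is shifted
by `p`. Almost continuity makes these integrals continuous in `p`, so finitely many tests and one
gap `c` serve the whole compact set `P` (`exists_finite_productTest_separating`).

An ergodic flow has only countably many non-ergodic positive times
(`countable_setOf_not_ergodic_vadd`), so uncountability in the SWR-property supplies a time `σ` that
also acts ergodically on `ρ`. By Birkhoff and Egorov, averages of the shifted tests converge
uniformly on a set of nearly full measure, forwards and backwards. Suppose two good points of one
fibre, `(x, y)` and `(x', y)`, have `x` close to `x'` and on different orbits. The switchable
property gives a long window on which `x` follows the `p`-shift of `x'`, while `y` is common. As `L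
/ M ≥ κ`, averages over the window are still near the integrals, so the shifted and unshifted
integrals nearly agree, against the gap (`ProductTest.abs_sub_le_of_shiftedCloseness`). Points on a
common orbit are excluded by the same comparison. So good points in a fibre are uniformly separated,
and such sets are countable (`exists_pos_measure_countable_slices`).

Countable fibres of positive mass force the conditional measures of `ρ` to have atoms. The mass of
the atom at a point is an invariant function, so it is a constant `c > 0`, and almost every fibre
consists of exactly `1 / c` atoms (`isFiniteExtension_of_countable_slices`). -/

theorem ae_eq_const_of_vadd_invariant {Z : Type*} [MeasurableSpace Z] [AddAction ℝ Z]
    (m : Measure Z) [ErgodicVAdd ℝ Z m] {g : Z → ℝ}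
    (hg : Measurable g) (hinv : ∀ (t : ℝ) z, g (t +ᵥ z) = g z) :
    ∃ c, g =ᵐ[m] Function.const Z c := by
  refine exists_eventuallyEq_const_of_forall_separating MeasurableSet fun U hU => ?_
  have h := aeconst_of_forall_preimage_vadd_ae_eq ℝ (μ := m) (s := g ⁻¹' U)
    (hg hU).nullMeasurableSet fun t => by
      have : (fun z => t +ᵥ z) ⁻¹' (g ⁻¹' U) = g ⁻¹' U := by ext z; simp [hinv]
      exact this.eventuallyEq
  exact eventuallyConst_set.1 h

variable {Z : Type*} [MeasurableSpace Z] [AddAction ℝ Z] [MeasurableVAdd₂ ℝ Z]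

instance instMeasurableVAddProd {X Y : Type*} [MeasurableSpace X] [MeasurableSpace Y]
    [AddAction ℝ X] [MeasurableVAdd₂ ℝ X] [AddAction ℝ Y] [MeasurableVAdd₂ ℝ Y] :
    MeasurableVAdd₂ ℝ (X × Y) where
  measurable_vadd := by
    have h : (Function.uncurry ((· +ᵥ ·) : ℝ → X × Y → X × Y)) =
        fun q => (q.1 +ᵥ q.2.1, q.1 +ᵥ q.2.2) := rfl
    rw [h]
    exact (measurable_fst.vadd measurable_snd.fst).prodMk (measurable_fst.vadd measurable_snd.snd)

theorem eventually_measure_symmDiff_vadd_lt [MeasurableSpace.CountablyGenerated Z]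
    (m : Measure Z) [IsProbabilityMeasure m] [VAddInvariantMeasure ℝ Z m]
    {B : Set Z} (hB : MeasurableSet B) {ε : ℝ} (hε : 0 < ε) :
    ∀ᶠ s in 𝓝 (0 : ℝ), m.real (((s +ᵥ ·) ⁻¹' B) ∆ B) < ε := by
  obtain ⟨𝒞, h𝒞c, h𝒞⟩ := exists_countable_measureDense m
  let V : Set Z → Set ℝ := fun C => {s | m (((s +ᵥ ·) ⁻¹' B) ∆ C) < ENNReal.ofReal (ε / 2)}
  have hVm : ∀ C ∈ 𝒞, MeasurableSet (V C) := by
    intro C hC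
    have hS : MeasurableSet {q : ℝ × Z | q.1 +ᵥ q.2 ∈ B} :=
      (measurable_fst.vadd measurable_snd) hB
    have hC' : MeasurableSet {q : ℝ × Z | q.2 ∈ C} := measurable_snd (h𝒞.measurable C hC)
    exact measurableSet_lt (measurable_measure_prodMk_left (hS.symmDiff hC')) measurable_const
  have hcover : (⋃ C ∈ 𝒞, V C) = univ := by
    refine eq_univ_of_forall fun s => ?_
    obtain ⟨C, hC, h⟩ := h𝒞.approx ((s +ᵥ ·) ⁻¹' B) ((measurable_const_vadd s) hB)
      (measure_ne_top _ _) (ε / 2) (by positivity)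
    exact mem_iUnion₂.2 ⟨C, hC, h⟩
  -- Countably many measurable sets of times cover `ℝ`, so one has positive Lebesgue measure; by
  -- Steinhaus its difference set is a neighbourhood of `0`.
  obtain ⟨C, hC, hpos⟩ : ∃ C ∈ 𝒞, 0 < (volume : Measure ℝ) (V C) := by
    by_contra! h
    have : (volume : Measure ℝ) (⋃ C ∈ 𝒞, V C) = 0 :=
      (measure_biUnion_null_iff h𝒞c).2 fun C hC => le_antisymm (h C hC) bot_le
    rw [hcover] at this
    simp at this
  have hnhds := Measure.sub_mem_nhds_zero_of_addHaar_pos (volume : Measure ℝ) (V C) (hVm C hC) hpos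
  filter_upwards [hnhds] with r hr
  obtain ⟨s, hs, t, ht, rfl⟩ := Set.mem_sub.1 hr
  have hinv : m ((((s - t : ℝ) +ᵥ ·) ⁻¹' B) ∆ B) =
      m (((s +ᵥ ·) ⁻¹' B) ∆ ((t +ᵥ ·) ⁻¹' B)) := by
    have hm := (measurable_const_vadd (α := Z) (s - t)) hB
    rw [← (measurePreserving_vadd t m).measure_preimage (hm.symmDiff hB).nullMeasurableSet]
    congr 1
    ext z
    simp [mem_symmDiff, vadd_vadd]
  have h1 : m ((((s - t : ℝ) +ᵥ ·) ⁻¹' B) ∆ B) < ENNReal.ofReal ε := by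
    rw [hinv]
    calc _ ≤ m (((s +ᵥ ·) ⁻¹' B) ∆ C) + m (C ∆ ((t +ᵥ ·) ⁻¹' B)) := measure_symmDiff_le _ _ _
      _ < ENNReal.ofReal (ε / 2) + ENNReal.ofReal (ε / 2) := by
        rw [symmDiff_comm C]
        exact ENNReal.add_lt_add hs ht
      _ = ENNReal.ofReal ε := by
        rw [← ENNReal.ofReal_add (by positivity) (by positivity)]
        ring_nf
  exact (ENNReal.lt_ofReal_iff_toReal_lt (measure_ne_top _ _)).1 h1

theorem continuous_measureReal_inter_vadd [MeasurableSpace.CountablyGenerated Z]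
    (m : Measure Z) [IsProbabilityMeasure m] [VAddInvariantMeasure ℝ Z m]
    {A B : Set Z} (hA : MeasurableSet A) (hB : MeasurableSet B) :
    Continuous fun s : ℝ => m.real (A ∩ (s +ᵥ ·) ⁻¹' B) := by
  rw [continuous_iff_continuousAt]
  intro t
  rw [ContinuousAt, Metric.tendsto_nhds]
  intro ε hε
  have h := eventually_measure_symmDiff_vadd_lt m hB hε
  have ht : Tendsto (fun s : ℝ => s - t) (𝓝 t) (𝓝 0) := by
    simpa using (continuous_id.sub continuous_const).tendsto (f := fun s : ℝ => s - t) t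
  filter_upwards [ht.eventually h] with s hs
  have hms := (measurable_const_vadd (α := Z) s) hB
  have hmt := (measurable_const_vadd (α := Z) t) hB
  rw [Real.dist_eq]
  refine lt_of_le_of_lt (abs_measureReal_sub_le_measureReal_symmDiff (hA.inter hms).nullMeasurableSet
    (hA.inter hmt).nullMeasurableSet) (lt_of_le_of_lt ?_ hs)
  have hm := (measurable_const_vadd (α := Z) (s - t)) hB
  rw [← (measurePreserving_vadd t m).measureReal_preimage (hm.symmDiff hB).nullMeasurableSet]
  refine measureReal_mono ?_
  intro z hz
  simp only [mem_symmDiff, mem_inter_iff, mem_preimage, vadd_vadd, sub_add_cancel] at hz ⊢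
  tauto

/-- Because `B` has period `p`, the time an orbit spends in `B` during one period does not depend on
the starting phase. It is thus a flow-invariant function, constant by ergodicity, and Fubini
decouples `A` from `B`. -/
theorem setIntegral_measureReal_inter_vadd_of_periodic
    (m : Measure Z) [IsProbabilityMeasure m] [ErgodicVAdd ℝ Z m]
    {A B : Set Z} (hA : MeasurableSet A) (hB : MeasurableSet B) {p : ℝ} (hp : 0 < p)
    (hper : (p +ᵥ ·) ⁻¹' B = B) :
    ∫ s in Ioc 0 p, m.real (A ∩ (s +ᵥ ·) ⁻¹' B) = p * (m.real A * m.real B) := by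
  let F : ℝ → Z → ℝ := fun s z => B.indicator 1 (s +ᵥ z)
  have hFm : Measurable (Function.uncurry F) :=
    (measurable_one.indicator hB).comp (measurable_fst.vadd measurable_snd)
  have hF1 : ∀ s z, ‖F s z‖ ≤ 1 := fun s z => by
    simp only [F, indicator]; split_ifs <;> simp
  let g : Z → ℝ := fun z => ∫ s in Ioc 0 p, F s z
  have hgm : Measurable g := by
    have : StronglyMeasurable (Function.uncurry fun z s => F s z) :=
      (hFm.comp measurable_swap).stronglyMeasurable
    exact this.integral_prod_right.measurable
  have hginv : ∀ (t : ℝ) z, g (t +ᵥ z) = g z := by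
    intro t z
    have hP : Function.Periodic (fun s => F s z) p := by
      intro s
      have : (s + p) +ᵥ z ∈ B ↔ s +ᵥ z ∈ B := by
        rw [add_comm, ← vadd_vadd]
        exact Set.ext_iff.1 hper (s +ᵥ z)
      by_cases h : s +ᵥ z ∈ B
      · simp only [F, indicator_of_mem h, indicator_of_mem (this.2 h), Pi.one_apply]
      · simp only [F, indicator_of_notMem h, indicator_of_notMem (mt this.1 h)]
    have h1 := hP.intervalIntegral_add_eq t 0
    have h2 : g (t +ᵥ z) = ∫ s in (0 : ℝ)..p, F (s + t) z := by
      rw [intervalIntegral.integral_of_le hp.le]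
      simp only [g, F, vadd_vadd]
    rw [h2, intervalIntegral.integral_comp_add_right (fun s => F s z)]
    rw [zero_add, add_comm p t, h1, zero_add, intervalIntegral.integral_of_le hp.le]
  obtain ⟨c, hc⟩ := ae_eq_const_of_vadd_invariant m hgm hginv
  have key : ∀ A : Set Z, MeasurableSet A →
      ∫ s in Ioc 0 p, m.real (A ∩ (s +ᵥ ·) ⁻¹' B) = m.real A * c := by
    intro A hA
    have h1 : ∀ s : ℝ, m.real (A ∩ (s +ᵥ ·) ⁻¹' B) = ∫ z in A, F s z ∂m := by
      intro s
      have : F s = ((s +ᵥ ·) ⁻¹' B).indicator 1 := rfl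
      rw [this, integral_indicator_one ((measurable_const_vadd s) hB),
        measureReal_restrict_apply ((measurable_const_vadd s) hB), inter_comm]
    simp_rw [h1]
    rw [integral_integral_swap]
    · change ∫ z in A, g z ∂m = _
      rw [integral_congr_ae (ae_restrict_of_ae hc)]
      simp
    · exact Integrable.of_bound hFm.aestronglyMeasurable 1 (ae_of_all _ fun q => hF1 _ _)
  have hu := key univ MeasurableSet.univ
  have : ∀ s : ℝ, m.real (univ ∩ (s +ᵥ ·) ⁻¹' B) = m.real B := fun s => by
    rw [univ_inter, (measurePreserving_vadd s m).measureReal_preimage hB.nullMeasurableSet]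
  simp only [this, integral_const, probReal_univ, one_mul, smul_eq_mul] at hu
  rw [key A hA, ← hu]
  simp [hp.le]
  ring

end FlowContinuity

/-! ### Ergodicity of individual time maps -/

section TimeMaps

theorem ergodicVAdd_of_ergodicVAdd_prod {Z : Type*} [MeasurableSpace Z]
    [AddAction ℝ Z] {m : Measure Z} [IsProbabilityMeasure m]
    [VAddInvariantMeasure ℝ Z m] [ErgodicVAdd ℝ (Z × Z) (m.prod m)] : ErgodicVAdd ℝ Z m where
  aeconst_of_forall_preimage_vadd_ae_eq := by
    intro s hs hinv
    have hq : Measure.QuasiMeasurePreserving (Prod.fst : Z × Z → Z) (m.prod m) m :=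
      Measure.quasiMeasurePreserving_fst
    have h := aeconst_of_forall_preimage_vadd_ae_eq ℝ (μ := m.prod m)
      (s := Prod.fst ⁻¹' s) (measurable_fst hs).nullMeasurableSet
      fun t => hq.preimage_ae_eq (hinv t)
    rw [eventuallyConst_set'] at h ⊢
    have hf : ∀ s : Set Z, (m.prod m) (Prod.fst ⁻¹' s) = m s := fun s => by
      rw [← prod_univ, Measure.prod_prod, measure_univ, mul_one]
    simpa only [ae_eq_empty, ae_eq_univ, ← preimage_compl, hf] using h

theorem IsWeaklyMixingFlow.ergodicVAdd {Z : Type*} [MeasurableSpace Z]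
    [AddAction ℝ Z] {m : Measure Z} [IsProbabilityMeasure m]
    (h : IsWeaklyMixingFlow m) : ErgodicVAdd ℝ Z m :=
  haveI := h.1
  haveI := h.2
  ergodicVAdd_of_ergodicVAdd_prod

variable {Z : Type*} [MeasurableSpace Z] [AddAction ℝ Z] [MeasurableVAdd₂ ℝ Z]

/-- The correlation of `A` with the translates of `B` is continuous and has both periods `a` and
`b`, which generate a dense subgroup. It is therefore constant, equal to its mean over a period of
`B`. -/
theorem measureReal_inter_of_irrational_periods [MeasurableSpace.CountablyGenerated Z]
    (m : Measure Z) [IsProbabilityMeasure m] [ErgodicVAdd ℝ Z m]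
    {A B : Set Z} (hA : MeasurableSet A) (hB : MeasurableSet B) {a b : ℝ} (hb : 0 < b)
    (hab : Irrational (a / b)) (hAa : (a +ᵥ ·) ⁻¹' A = A) (hBb : (b +ᵥ ·) ⁻¹' B = B) :
    m.real (A ∩ B) = m.real A * m.real B := by
  let u : ℝ → ℝ := fun s => m.real (A ∩ (s +ᵥ ·) ⁻¹' B)
  have hu : Continuous u := continuous_measureReal_inter_vadd m hA hB
  have hua : ∀ r, u (r + a) = u r := by
    intro r
    have hm : MeasurableSet (A ∩ (r +ᵥ ·) ⁻¹' B) := hA.inter ((measurable_const_vadd r) hB)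
    have h := (measurePreserving_vadd a m).measureReal_preimage hm.nullMeasurableSet
    rw [preimage_inter, hAa] at h
    change _ = u r at h
    rw [← h]
    simp only [u]
    congr 2
    ext z
    simp [vadd_vadd]
  have hub : ∀ r, u (r + b) = u r := by
    intro r
    have : (((r + b : ℝ) +ᵥ ·) ⁻¹' B : Set Z) = (r +ᵥ ·) ⁻¹' B := by
      ext z
      rw [add_comm, mem_preimage, mem_preimage, ← vadd_vadd]
      exact Set.ext_iff.1 hBb (r +ᵥ z)
    simp only [u, this]
  have hper : ∀ s ∈ AddSubgroup.closure {a, b}, ∀ r, u (r + s) = u r := by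
    intro s hs
    induction hs using AddSubgroup.closure_induction with
    | mem x hx => rcases hx with rfl | rfl <;> assumption
    | zero => simp
    | add x y _ _ hx hy => intro r; rw [← add_assoc, hy, hx]
    | neg x _ hx => intro r; rw [← hx (r + -x)]; simp
  have hconst : u = fun _ => u 0 :=
    hu.ext_on (dense_addSubgroupClosure_pair_iff.2 hab) continuous_const fun s hs => by
      simpa using hper s hs 0
  have hint := setIntegral_measureReal_inter_vadd_of_periodic m hA hB hb hBb
  change ∫ s in Ioc 0 b, u s = _ at hint
  rw [hconst] at hint
  simp only [integral_const, measureReal_restrict_apply_univ, Real.volume_real_Ioc, sub_zero,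
    max_eq_left hb.le, smul_eq_mul, mul_eq_mul_left_iff, hb.ne', or_false] at hint
  simpa [u] using hint

theorem exists_invariant_of_not_ergodic_vadd
    (m : Measure Z) [IsProbabilityMeasure m] [VAddInvariantMeasure ℝ Z m] {t : ℝ}
    (ht : ¬ Ergodic (t +ᵥ · : Z → Z) m) :
    ∃ A : Set Z, MeasurableSet A ∧ (t +ᵥ ·) ⁻¹' A = A ∧ 0 < m.real A ∧ m.real A < 1 := by
  have h : ¬ PreErgodic (t +ᵥ · : Z → Z) m := fun h =>
    ht { measurePreserving_vadd t m with aeconst_set := h.aeconst_set }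
  have h' : ∃ A : Set Z, MeasurableSet A ∧ (t +ᵥ ·) ⁻¹' A = A ∧ ¬ EventuallyConst A (ae m) := by
    by_contra! h'
    exact h ⟨h'⟩
  obtain ⟨A, hA, hAi, hAc⟩ := h'
  rw [eventuallyConst_set', not_or, ae_eq_empty, ae_eq_univ, prob_compl_eq_zero_iff hA] at hAc
  refine ⟨A, hA, hAi, ?_, ?_⟩
  · exact ENNReal.toReal_pos hAc.1 (measure_ne_top _ _)
  · refine lt_of_le_of_ne measureReal_le_one fun h => hAc.2 ?_
    rwa [measureReal_def, ENNReal.toReal_eq_one_iff] at h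

/-- Invariant sets for times of irrational ratio are independent, hence far apart in the measure
algebra. Separability then leaves only countably many rational classes of non-ergodic times. -/
theorem countable_setOf_not_ergodic_vadd [MeasurableSpace.CountablyGenerated Z]
    (m : Measure Z) [IsProbabilityMeasure m] [ErgodicVAdd ℝ Z m] :
    {t : ℝ | 0 < t ∧ ¬ Ergodic (t +ᵥ · : Z → Z) m}.Countable := by
  obtain ⟨𝒞, h𝒞c, h𝒞⟩ := exists_countable_measureDense m
  let D : ℕ → Set Z → Set ℝ := fun n C => {t | 0 < t ∧ ∃ A : Set Z, MeasurableSet A ∧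
    (t +ᵥ ·) ⁻¹' A = A ∧ 1 / (n + 1 : ℝ) ≤ m.real A ∧ 1 / (n + 1 : ℝ) ≤ 1 - m.real A ∧
    m (A ∆ C) < ENNReal.ofReal (1 / (n + 1 : ℝ) / 2)}
  have hsub : {t : ℝ | 0 < t ∧ ¬ Ergodic (t +ᵥ · : Z → Z) m} ⊆ ⋃ n, ⋃ C ∈ 𝒞, D n C := by
    rintro t ⟨ht, hte⟩
    obtain ⟨A, hA, hAi, h0, h1⟩ := exists_invariant_of_not_ergodic_vadd m hte
    obtain ⟨n, hn⟩ := exists_nat_one_div_lt (lt_min h0 (sub_pos.2 h1))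
    obtain ⟨C, hC, hAC⟩ := h𝒞.approx A hA (measure_ne_top _ _) (1 / (n + 1 : ℝ) / 2)
      (by positivity)
    refine mem_iUnion.2 ⟨n, mem_iUnion₂.2 ⟨C, hC, ht, A, hA, hAi, ?_, ?_, hAC⟩⟩
    · exact (hn.trans_le (min_le_left _ _)).le
    · exact (hn.trans_le (min_le_right _ _)).le
  refine Countable.mono hsub (countable_iUnion fun n => h𝒞c.biUnion fun C _ => ?_)
  rcases (D n C).eq_empty_or_nonempty with h | ⟨b, hb, B, hB, hBb, hB0, hB1, hBC⟩
  · rw [h]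
    exact countable_empty
  refine (countable_range fun q : ℚ => (q : ℝ) * b).mono ?_
  rintro a ⟨ha, A, hA, hAa, hA0, hA1, hAC⟩
  by_contra hrat
  have hirr : Irrational (a / b) := by
    rintro ⟨q, hq⟩
    exact hrat ⟨q, by simp only [hq]; field_simp⟩
  have hind := measureReal_inter_of_irrational_periods m hA hB hb hirr hAa hBb
  have hlt : m.real (A ∆ B) < 1 / (n + 1 : ℝ) := by
    refine (ENNReal.lt_ofReal_iff_toReal_lt (measure_ne_top _ _)).1 ?_
    calc m (A ∆ B) ≤ m (A ∆ C) + m (C ∆ B) := measure_symmDiff_le _ _ _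
      _ < ENNReal.ofReal (1 / (n + 1 : ℝ) / 2) + ENNReal.ofReal (1 / (n + 1 : ℝ) / 2) := by
        rw [symmDiff_comm C]
        exact ENNReal.add_lt_add hAC hBC
      _ = ENNReal.ofReal (1 / (n + 1 : ℝ)) := by
        rw [← ENNReal.ofReal_add (by positivity) (by positivity), add_halves]
  have h1 := measureReal_inter_add_sdiff (μ := m) (s := A) hB
  have h2 := measureReal_inter_add_sdiff (μ := m) (s := B) hA
  rw [inter_comm] at h2
  have h3 := measureReal_symmDiff_eq (μ := m) hA hB
  have hb0 : 0 ≤ m.real B := measureReal_nonneg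
  have hb1 : m.real B ≤ 1 := measureReal_le_one
  -- Independence gives `m (A ∆ B) = α (1 - β) + β (1 - α)`, where `α`, `β` are the measures of `A`,
  -- `B`. This is at least `1 / (n + 1)` since both `α` and `1 - α` are, contradicting `hlt`.
  nlinarith

/-- For a `T_p`-invariant `A` of measure `a`, the autocorrelation has mean `a ^ 2` over a period by
ergodicity of the flow, and its square has mean `a ^ 4` by ergodicity of the Cartesian square. Its
variance vanishes, so its value `a` at time `0` equals `a ^ 2`. -/
theorem IsWeaklyMixingFlow.ergodic_vadd_of_pos [MeasurableSpace.CountablyGenerated Z]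
    {m : Measure Z} [IsProbabilityMeasure m]
    (h : IsWeaklyMixingFlow m) {p : ℝ} (hp : 0 < p) : Ergodic (p +ᵥ · : Z → Z) m := by
  have := h.1
  have := h.2
  have := h.ergodicVAdd
  by_contra hne
  obtain ⟨A, hA, hAi, h0, h1⟩ := exists_invariant_of_not_ergodic_vadd m hne
  let u : ℝ → ℝ := fun s => m.real (A ∩ (s +ᵥ ·) ⁻¹' A)
  have hu : Continuous u := continuous_measureReal_inter_vadd m hA hA
  have hi1 : ∫ s in Ioc 0 p, u s = p * (m.real A * m.real A) :=
    setIntegral_measureReal_inter_vadd_of_periodic m hA hA hp hAi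
  have hi2 : ∫ s in Ioc 0 p, (m.prod m).real ((A ×ˢ A) ∩ (s +ᵥ ·) ⁻¹' (A ×ˢ A)) =
      p * ((m.prod m).real (A ×ˢ A) * (m.prod m).real (A ×ˢ A)) := by
    refine setIntegral_measureReal_inter_vadd_of_periodic _ (hA.prod hA) (hA.prod hA) hp ?_
    ext ⟨z, w⟩
    have hz := Set.ext_iff.1 hAi
    exact and_congr (hz z) (hz w)
  have hsq : ∀ s : ℝ, (m.prod m).real ((A ×ˢ A) ∩ (s +ᵥ ·) ⁻¹' (A ×ˢ A)) = u s ^ 2 := by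
    intro s
    have : ((A ×ˢ A) ∩ (s +ᵥ ·) ⁻¹' (A ×ˢ A) : Set (Z × Z)) =
        (A ∩ (s +ᵥ ·) ⁻¹' A) ×ˢ (A ∩ (s +ᵥ ·) ⁻¹' A) := by
      ext ⟨z, w⟩
      simp only [mem_inter_iff, mem_prod, mem_preimage, Prod.vadd_mk]
      tauto
    rw [this, measureReal_prod_prod, sq]
  simp only [hsq, measureReal_prod_prod] at hi2
  rw [← intervalIntegral.integral_of_le hp.le] at hi1 hi2
  set a := m.real A
  have hvar : ∫ s in (0 : ℝ)..p, (u s - a * a) ^ 2 = 0 := by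
    have hexp : ∀ s, (u s - a * a) ^ 2 = u s ^ 2 - 2 * (a * a) * u s + (a * a) ^ 2 := fun s => by
      ring
    simp only [hexp]
    have c1 : IntervalIntegrable (fun s => u s ^ 2) volume 0 p :=
      (hu.pow 2).intervalIntegrable _ _
    have c2 : IntervalIntegrable (fun s => 2 * (a * a) * u s) volume 0 p :=
      (hu.const_mul _).intervalIntegrable _ _
    rw [intervalIntegral.integral_add (c1.sub c2) (by simp),
      intervalIntegral.integral_sub c1 c2, intervalIntegral.integral_const_mul, hi1, hi2]
    simp
    ring
  have hzero : u 0 = a * a := by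
    by_contra hne
    have hpos : 0 < ∫ s in (0 : ℝ)..p, (u s - a * a) ^ 2 := by
      refine intervalIntegral.integral_pos hp ((hu.sub continuous_const).pow 2).continuousOn
        (fun s _ => sq_nonneg _) ⟨0, ⟨le_rfl, hp.le⟩, ?_⟩
      exact sq_pos_of_ne_zero (sub_ne_zero.2 hne)
    exact hpos.ne' hvar
  have : u 0 = a := by simp [u, a]
  nlinarith

theorem Ergodic.neg_vadd {m : Measure Z} {t : ℝ} (h : Ergodic (t +ᵥ · : Z → Z) m) :
    Ergodic ((-t) +ᵥ · : Z → Z) m :=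
  Ergodic.symm (e := MeasurableEquiv.vadd t) h

theorem IsWeaklyMixingFlow.ergodic_vadd [MeasurableSpace.CountablyGenerated Z]
    {m : Measure Z} [IsProbabilityMeasure m]
    (h : IsWeaklyMixingFlow m) {p : ℝ} (hp : p ≠ 0) : Ergodic (p +ᵥ · : Z → Z) m := by
  rcases hp.lt_or_gt with hp | hp
  · simpa using (h.ergodic_vadd_of_pos (neg_pos.2 hp)).neg_vadd
  · exact h.ergodic_vadd_of_pos hp

end TimeMaps

/-! ### Maximal and pointwise ergodic theorems -/

section Birkhoff

variable {Z : Type*} [MeasurableSpace Z] {m : Measure Z} {T : Z → Z} {f : Z → ℝ}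

/-- The running maximum `max_{k ≤ n} S_k f` of the Birkhoff sums of `f`. -/
def birkhoffMax (T : Z → Z) (f : Z → ℝ) : ℕ → Z → ℝ
  | 0, _ => 0
  | n + 1, x => max 0 (f x + birkhoffMax T f n (T x))

omit [MeasurableSpace Z] in
theorem birkhoffMax_nonneg (n : ℕ) (x : Z) : 0 ≤ birkhoffMax T f n x := by
  cases n
  · exact le_rfl
  · exact le_max_left _ _

omit [MeasurableSpace Z] in
theorem birkhoffMax_le_succ (n : ℕ) (x : Z) : birkhoffMax T f n x ≤ birkhoffMax T f (n + 1) x := by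
  induction n generalizing x with
  | zero => exact birkhoffMax_nonneg _ _
  | succ n ih => exact max_le_max le_rfl (add_le_add le_rfl (ih (T x)))

omit [MeasurableSpace Z] in
theorem birkhoffSum_le_birkhoffMax (n : ℕ) (x : Z) : birkhoffSum T f n x ≤ birkhoffMax T f n x := by
  induction n generalizing x with
  | zero => simp [birkhoffMax]
  | succ n ih =>
    rw [birkhoffSum_succ']
    exact (add_le_add le_rfl (ih (T x))).trans (le_max_right _ _)

omit [MeasurableSpace Z] in
theorem birkhoffMax_le_of_pos {n : ℕ} {x : Z} (h : 0 < birkhoffMax T f n x) :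
    birkhoffMax T f n x ≤ f x + birkhoffMax T f n (T x) := by
  cases n with
  | zero => exact absurd h (lt_irrefl _)
  | succ n =>
    have h1 : birkhoffMax T f (n + 1) x = f x + birkhoffMax T f n (T x) := by
      refine max_eq_right (le_of_lt ?_)
      by_contra! h2
      exact h.ne' (max_eq_left h2)
    rw [h1]
    exact add_le_add le_rfl (birkhoffMax_le_succ _ _)

theorem measurable_birkhoffMax (hT : Measurable T) (hf : Measurable f) (n : ℕ) :
    Measurable (birkhoffMax T f n) := by
  induction n with
  | zero => exact measurable_const
  | succ n ih => exact measurable_const.max (hf.add (ih.comp hT))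

theorem integrable_birkhoffMax (hT : MeasurePreserving T m m) (hf : Integrable f m) (n : ℕ) :
    Integrable (birkhoffMax T f n) m := by
  induction n with
  | zero => exact integrable_zero _ _ _
  | succ n ih =>
    exact (integrable_zero _ _ _).sup (hf.add (hT.integrable_comp_of_integrable ih))

/-- Garsia's argument: on `D` one has `f ≥ M - M ∘ T` for the running maximum `M`. As `M` is
nonnegative and vanishes off `D`, invariance of the measure makes the integral of the right side
over `D` nonnegative. -/
theorem setIntegral_birkhoffMax_pos_nonneg (hT : MeasurePreserving T m m) (hfm : Measurable f)
    (hf : Integrable f m) (n : ℕ) : 0 ≤ ∫ x in {x | 0 < birkhoffMax T f n x}, f x ∂m := by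
  set D := {x | 0 < birkhoffMax T f n x}
  have hM := integrable_birkhoffMax hT hf n
  have hMT : Integrable (fun x => birkhoffMax T f n (T x)) m := hT.integrable_comp_of_integrable hM
  have hD : MeasurableSet D :=
    measurableSet_lt measurable_const (measurable_birkhoffMax hT.measurable hfm n)
  have h1 : ∫ x in D, (birkhoffMax T f n x - birkhoffMax T f n (T x)) ∂m ≤ ∫ x in D, f x ∂m := by
    refine setIntegral_mono_on (hM.sub hMT).integrableOn hf.integrableOn hD fun x hx => ?_
    have := birkhoffMax_le_of_pos hx
    linarith
  have h2 : ∫ x in D, birkhoffMax T f n x ∂m = ∫ x, birkhoffMax T f n x ∂m := by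
    refine setIntegral_eq_integral_of_forall_compl_eq_zero fun x hx => ?_
    exact le_antisymm (not_lt.1 hx) (birkhoffMax_nonneg _ _)
  have h3 : ∫ x in D, birkhoffMax T f n (T x) ∂m ≤ ∫ x, birkhoffMax T f n (T x) ∂m :=
    setIntegral_le_integral hMT (ae_of_all _ fun x => birkhoffMax_nonneg _ _)
  have h4 : ∫ x, birkhoffMax T f n (T x) ∂m = ∫ x, birkhoffMax T f n x ∂m := by
    have h := integral_map (μ := m) (f := birkhoffMax T f n) hT.measurable.aemeasurable
      (measurable_birkhoffMax hT.measurable hfm n).aestronglyMeasurable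
    rw [hT.map_eq] at h
    exact h.symm
  rw [integral_sub hM.integrableOn hMT.integrableOn] at h1
  linarith

/-- A form of the maximal ergodic theorem. -/
theorem integral_nonneg_of_ae_exists_birkhoffSum_pos (hT : MeasurePreserving T m m)
    (hfm : Measurable f) (hf : Integrable f m) (h : ∀ᵐ x ∂m, ∃ n, 0 < birkhoffSum T f n x) :
    0 ≤ ∫ x, f x ∂m := by
  let D : ℕ → Set Z := fun n => {x | 0 < birkhoffMax T f n x}
  have hD : ∀ n, MeasurableSet (D n) := fun n =>
    measurableSet_lt measurable_const (measurable_birkhoffMax hT.measurable hfm n)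
  have hmono : Monotone D := monotone_nat_of_le_succ fun n x hx =>
    lt_of_lt_of_le hx (birkhoffMax_le_succ n x)
  have hU : (⋃ n, D n) =ᵐ[m] univ := by
    rw [eventuallyEq_univ]
    filter_upwards [h] with x ⟨n, hn⟩
    exact mem_iUnion.2 ⟨n, hn.trans_le (birkhoffSum_le_birkhoffMax n x)⟩
  have ht := tendsto_setIntegral_of_monotone hD hmono hf.integrableOn
  rw [setIntegral_congr_set hU, setIntegral_univ] at ht
  exact ge_of_tendsto' ht fun n => setIntegral_birkhoffMax_pos_nonneg hT hfm hf n

theorem measurable_birkhoffSum (hT : Measurable T) (hf : Measurable f) (n : ℕ) :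
    Measurable (birkhoffSum T f n) :=
  Finset.measurable_sum _ fun k _ => hf.comp (hT.iterate k)

/-- The points whose averages exceed some rational `q > c` infinitely often form a measurable set
contained in its preimage, so it is null or conull. If conull, the maximal ergodic theorem for `f -
c` contradicts `∫ f < c`. -/
theorem ae_eventually_birkhoffSum_le [IsProbabilityMeasure m] (hT : Ergodic T m)
    (hfm : Measurable f) (hf : Integrable f m) {c : ℝ} (hc : ∫ x, f x ∂m < c) :
    ∀ᵐ x ∂m, ∀ q : ℚ, c < q → ∀ᶠ n : ℕ in atTop, birkhoffSum T f n x ≤ q * n := by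
  let U : Set Z := {x | ∃ q : ℚ, c < q ∧ ∃ᶠ n : ℕ in atTop, (q : ℝ) * n < birkhoffSum T f n x}
  have hUm : MeasurableSet U := by
    have : U = ⋃ q : ℚ, ⋃ _ : c < q, ⋂ N : ℕ, ⋃ n : ℕ, ⋃ _ : N ≤ n,
        {x | (q : ℝ) * n < birkhoffSum T f n x} := by
      ext x
      simp [U, frequently_atTop]
    rw [this]
    exact .iUnion fun q => .iUnion fun _ => .iInter fun N => .iUnion fun n => .iUnion fun _ =>
      measurableSet_lt measurable_const (measurable_birkhoffSum hT.measurable hfm n)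
  have hUT : U ⊆ T ⁻¹' U := by
    rintro x ⟨q, hcq, hq⟩
    obtain ⟨q', hcq', hq'⟩ := exists_rat_btwn hcq
    refine ⟨q', hcq', ?_⟩
    -- Dropping the first term of the sum costs `f x`, which the linear gap between `q` and the
    -- smaller `q'` eventually absorbs.
    have hlarge : ∀ᶠ n : ℕ in atTop, f x - q < (q - q') * n := by
      have : Tendsto (fun n : ℕ => ((q : ℝ) - q') * n) atTop atTop :=
        tendsto_natCast_atTop_atTop.const_mul_atTop (sub_pos.2 hq')
      exact this.eventually_gt_atTop _
    have hq1 : ∃ᶠ n : ℕ in atTop, (q : ℝ) * (n + 1 : ℕ) < birkhoffSum T f (n + 1) x := by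
      rw [frequently_atTop] at hq ⊢
      intro N
      obtain ⟨n, hn, h⟩ := hq (N + 1)
      obtain ⟨k, rfl⟩ : ∃ k, n = k + 1 := ⟨n - 1, by omega⟩
      exact ⟨k, by omega, h⟩
    refine (hq1.and_eventually hlarge).mono fun n hn => ?_
    have h1 := hn.1
    rw [birkhoffSum_succ'] at h1
    push_cast at h1
    linarith [hn.2]
  have hnot : ¬ U =ᵐ[m] univ := by
    intro hU
    have hpos : ∀ᵐ x ∂m, ∃ n, 0 < birkhoffSum T (fun x => f x - c) n x := by
      filter_upwards [eventuallyEq_univ.1 hU] with x ⟨q, hcq, hq⟩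
      obtain ⟨n, hn, h⟩ := frequently_atTop.1 hq 0
      refine ⟨n, ?_⟩
      have : birkhoffSum T (fun x => f x - c) n x = birkhoffSum T f n x - n * c := by
        simp [birkhoffSum]
      rw [this]
      have : (n : ℝ) * c ≤ q * n := by
        rw [mul_comm]
        exact mul_le_mul_of_nonneg_right hcq.le n.cast_nonneg
      linarith
    have := integral_nonneg_of_ae_exists_birkhoffSum_pos hT.toMeasurePreserving
      (hfm.sub_const c) (hf.sub (integrable_const c)) hpos
    rw [integral_sub hf (integrable_const c)] at this
    simp at this
    linarith
  have hU : U =ᵐ[m] (∅ : Set Z) :=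
    (hT.ae_empty_or_univ_of_ae_le_preimage hUm.nullMeasurableSet
      (LE.le.eventuallyLE hUT)).resolve_right hnot
  filter_upwards [eventuallyEq_empty.1 hU] with x hx q hq
  by_contra h
  refine hx ⟨q, hq, ?_⟩
  simpa only [not_eventually, not_le] using h

/-- Birkhoff's pointwise ergodic theorem for an ergodic map. -/
theorem ae_tendsto_birkhoffAverage [IsProbabilityMeasure m] (hT : Ergodic T m)
    (hfm : Measurable f) (hf : Integrable f m) :
    ∀ᵐ x ∂m, Tendsto (fun n => birkhoffAverage ℝ T f n x) atTop (𝓝 (∫ x, f x ∂m)) := by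
  have key : ∀ g : Z → ℝ, Measurable g → Integrable g m → ∀ᵐ x ∂m, ∀ k : ℕ,
      ∀ᶠ n : ℕ in atTop, birkhoffAverage ℝ T g n x ≤ (∫ x, g x ∂m) + 1 / (k + 1 : ℝ) := by
    intro g hgm hg
    rw [ae_all_iff]
    intro k
    have hk : (0 : ℝ) < 1 / (k + 1 : ℝ) := by positivity
    obtain ⟨c, hc, hck⟩ := exists_between (lt_add_of_pos_right (∫ x, g x ∂m) hk)
    obtain ⟨q, hcq, hq⟩ := exists_rat_btwn hck
    filter_upwards [ae_eventually_birkhoffSum_le hT hgm hg hc] with x hx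
    filter_upwards [hx q hcq, eventually_gt_atTop 0] with n hn hn0
    have hn0' : (0 : ℝ) < n := Nat.cast_pos.2 hn0
    rw [birkhoffAverage, smul_eq_mul, inv_mul_le_iff₀ hn0', mul_comm]
    exact hn.trans (mul_le_mul_of_nonneg_right hq.le hn0'.le)
  filter_upwards [key f hfm hf, key (-f) hfm.neg hf.neg] with x h1 h2
  rw [Metric.tendsto_nhds]
  intro ε hε
  obtain ⟨k, hk⟩ := exists_nat_one_div_lt hε
  filter_upwards [h1 k, h2 k] with n hn1 hn2
  rw [birkhoffAverage_neg, Pi.neg_apply, Pi.neg_apply] at hn2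
  simp only [Pi.neg_apply, integral_neg] at hn2
  rw [Real.dist_eq, abs_lt]
  constructor <;> linarith

end Birkhoff

/-- Every subset of `D` is closed, hence Borel. An uncountable `D` would be Borel isomorphic to `ℝ`,
making all subsets of `ℝ` Borel, although there are only continuum many Borel sets. Separability of
the metric is not presupposed. -/
theorem countable_of_separated {X : Type*} [MetricSpace X] [MeasurableSpace X] [BorelSpace X]
    [StandardBorelSpace X] {D : Set X} {δ : ℝ} (hδ : 0 < δ)
    (hD : D.Pairwise fun x y => δ ≤ dist x y) : D.Countable := by
  have hsub : ∀ S ⊆ D, MeasurableSet S := by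
    intro S hS
    refine IsClosed.measurableSet ?_
    refine Metric.isClosed_of_pairwise_le_dist hδ ?_
    exact hD.mono hS
  have : StandardBorelSpace D := (hsub D Subset.rfl).standardBorel
  have hall : ∀ S : Set D, MeasurableSet S := fun S => by
    refine (MeasurableEmbedding.subtype_coe (hsub D Subset.rfl)).measurableSet_image.1 ?_
    exact hsub _ (Subtype.coe_image_subset _ _)
  by_contra hc
  have hc' : ¬ Countable D := fun h => hc (countable_coe_iff.1 h)
  let e : D ≃ᵐ ℝ := PolishSpace.measurableEquivOfNotCountable hc' not_countable
  have hℝ : ∀ S : Set ℝ, MeasurableSet S := fun S => by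
    have := e.symm.measurable (hall (e ⁻¹' S))
    rwa [← preimage_comp, e.self_comp_symm, preimage_id] at this
  obtain ⟨b, hbc, hb⟩ := MeasurableSpace.CountablyGenerated.isCountablyGenerated (α := ℝ)
  have hcard := MeasurableSpace.cardinal_measurableSet_le_continuum (s := b)
    ((Cardinal.le_aleph0_iff_set_countable.2 hbc).trans Cardinal.aleph0_le_continuum)
  rw [← hb] at hcard
  have huniv : {t : Set ℝ | MeasurableSet t} = univ := eq_univ_of_forall hℝ
  rw [huniv, Cardinal.mk_univ, Cardinal.mk_set, Cardinal.mk_real] at hcard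
  exact absurd (Cardinal.cantor _) (not_lt.2 hcard)

/-! ### Uniform ergodic averages on large sets -/

section Egorov

variable {Z : Type*} [MeasurableSpace Z] {m : Measure Z} {T : Z → Z}

theorem exists_birkhoffAverage_uniform_of_finset [IsProbabilityMeasure m] (hT : Ergodic T m)
    {ι : Type*} (F : Finset ι) (f : ι → Z → ℝ) (hfm : ∀ i, Measurable (f i))
    (hf : ∀ i, Integrable (f i) m) {η : ℝ} (hη : 0 < η) {ε : ℝ} (hε : 0 < ε) :
    ∃ (N : ℕ) (G : Set Z), MeasurableSet G ∧ 1 - ε ≤ m.real G ∧ ∀ z ∈ G, ∀ n ≥ N, ∀ i ∈ F,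
      |birkhoffAverage ℝ T (f i) n z - ∫ w, f i w ∂m| ≤ η := by
  classical
  induction F using Finset.induction_on generalizing ε with
  | empty => exact ⟨0, univ, .univ, by simp [hε.le], by simp⟩
  | insert i F _ ih =>
    obtain ⟨N, G, hG, hmG, h⟩ := ih (half_pos hε)
    obtain ⟨t, ht, hmt, hunif⟩ := tendstoUniformlyOn_of_ae_tendsto'
      (f := fun n z => birkhoffAverage ℝ T (f i) n z) (g := fun _ => ∫ w, f i w ∂m)
      (fun n => ((measurable_birkhoffSum hT.measurable (hfm i) n).const_smul
        ((n : ℝ)⁻¹)).stronglyMeasurable)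
      stronglyMeasurable_const (ae_tendsto_birkhoffAverage hT (hfm i) (hf i)) (half_pos hε)
    obtain ⟨N', hN'⟩ := eventually_atTop.1 (Metric.tendstoUniformlyOn_iff.1 hunif η hη)
    refine ⟨max N N', G \ t, hG.diff ht, ?_, ?_⟩
    · have h1 : m.real t ≤ ε / 2 := ENNReal.toReal_le_of_le_ofReal (by positivity) hmt
      have h2 := le_measureReal_sdiff (μ := m) (s₁ := G) (s₂ := t)
      linarith
    · intro z hz n hn j hj
      rcases Finset.mem_insert.1 hj with rfl | hj
      · have := hN' n ((le_max_right _ _).trans hn) z hz.2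
        rw [dist_comm, Real.dist_eq] at this
        exact this.le
      · exact h z hz.1 n ((le_max_left _ _).trans hn) j hj

end Egorov

/-- A test function `(x, y) ↦ 1_B(y) φ(x)` on `X × Y`, with `φ` Lipschitz. -/
structure ProductTest (X Y : Type*) [MetricSpace X] [MeasurableSpace Y] where
  φ : X → ℝ
  B : Set Y
  lipschitz : LipschitzWith 1 φ
  nonneg : ∀ x, 0 ≤ φ x
  le_one : ∀ x, φ x ≤ 1
  measurableSet : MeasurableSet B

/-! ### Bounds and measurability of the test functions -/

namespace ProductTest

variable {X Y : Type*} [MetricSpace X] [MeasurableSpace Y] [AddAction ℝ X]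

/-- The test function `1_B(y) φ(T_s x)` shifted in the first coordinate. -/
noncomputable def eval (f : ProductTest X Y) (s : ℝ) (z : X × Y) : ℝ :=
  f.B.indicator (fun _ => f.φ (s +ᵥ z.1)) z.2

theorem eval_nonneg (f : ProductTest X Y) (s : ℝ) (z : X × Y) : 0 ≤ f.eval s z :=
  indicator_nonneg (fun _ _ => f.nonneg _) _

theorem eval_le_one (f : ProductTest X Y) (s : ℝ) (z : X × Y) : f.eval s z ≤ 1 :=
  indicator_le' (fun _ _ => f.le_one _) (fun _ _ => zero_le_one) _

theorem norm_eval_le_one (f : ProductTest X Y) (s : ℝ) (z : X × Y) : ‖f.eval s z‖ ≤ 1 := by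
  rw [Real.norm_of_nonneg (f.eval_nonneg s z)]
  exact f.eval_le_one s z

theorem abs_eval_sub_eval_le_one (f : ProductTest X Y) (s t : ℝ) (z w : X × Y) :
    |f.eval s z - f.eval t w| ≤ 1 := by
  have h1 := f.eval_nonneg s z
  have h2 := f.eval_le_one s z
  have h3 := f.eval_nonneg t w
  have h4 := f.eval_le_one t w
  rw [abs_le]
  constructor <;> linarith

theorem abs_eval_sub_eval_le_dist (f : ProductTest X Y) (s t : ℝ) (x x' : X) (y : Y) :
    |f.eval s (x, y) - f.eval t (x', y)| ≤ dist (s +ᵥ x) (t +ᵥ x') := by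
  by_cases hy : y ∈ f.B
  · simp only [eval, indicator_of_mem hy]
    simpa [Real.dist_eq] using f.lipschitz.dist_le_mul (s +ᵥ x) (t +ᵥ x')
  · simp [eval, hy]

variable [MeasurableSpace X] [BorelSpace X] [MeasurableVAdd₂ ℝ X]

theorem measurable_eval (f : ProductTest X Y) (s : ℝ) : Measurable (f.eval s) := by
  have h : f.eval s = (Prod.snd ⁻¹' f.B).indicator fun z : X × Y => f.φ (s +ᵥ z.1) := rfl
  rw [h]
  exact (f.lipschitz.continuous.measurable.comp (measurable_fst.const_vadd s)).indicator
    (measurable_snd f.measurableSet)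

theorem integrable_eval (f : ProductTest X Y) (s : ℝ) (ρ : Measure (X × Y)) [IsFiniteMeasure ρ] :
    Integrable (f.eval s) ρ :=
  Integrable.of_bound (f.measurable_eval s).aestronglyMeasurable 1
    (ae_of_all _ fun z => f.norm_eval_le_one s z)

end ProductTest

section IndicatorFst

variable {X Y : Type*} [MeasurableSpace X] [AddAction ℝ X] [MeasurableVAdd₂ ℝ X]
  [MeasurableSpace Y] {μ : Measure X} {ρ : Measure (X × Y)}

theorem integral_indicator_vadd_fst [VAddInvariantMeasure ℝ X μ]
    (hρ : ρ.map Prod.fst = μ) {C : Set X} (hC : MeasurableSet C) (t : ℝ) :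
    ∫ z, C.indicator (1 : X → ℝ) (t +ᵥ z.1) ∂ρ = μ.real C := by
  have hm : MeasurableSet ((fun z : X × Y => t +ᵥ z.1) ⁻¹' C) :=
    (measurable_fst.const_vadd t) hC
  have h : (fun z : X × Y => C.indicator (1 : X → ℝ) (t +ᵥ z.1)) =
      ((fun z : X × Y => t +ᵥ z.1) ⁻¹' C).indicator 1 := rfl
  rw [h, integral_indicator_one hm]
  have h2 : ((fun z : X × Y => t +ᵥ z.1) ⁻¹' C) = Prod.fst ⁻¹' ((t +ᵥ ·) ⁻¹' C) := rfl
  rw [h2, ← map_measureReal_apply measurable_fst ((measurable_const_vadd t) hC), hρ,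
    (measurePreserving_vadd t μ).measureReal_preimage hC.nullMeasurableSet]

theorem integrable_indicator_vadd_fst [IsProbabilityMeasure ρ] {C : Set X} (hC : MeasurableSet C) (t : ℝ) :
    Integrable (fun z : X × Y => C.indicator (1 : X → ℝ) (t +ᵥ z.1)) ρ :=
  Integrable.of_bound ((measurable_one.indicator hC).comp
    (measurable_fst.const_vadd t)).aestronglyMeasurable 1 (ae_of_all _ fun z => by
      by_cases h : t +ᵥ z.1 ∈ C <;> simp [h])

end IndicatorFst

/-! ### Almost continuity and uniformity over compact sets of shifts -/

section AlmostContinuous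

variable {X Y : Type*} [MetricSpace X] [MeasurableSpace X] [BorelSpace X] [AddAction ℝ X]
  [MeasurableVAdd₂ ℝ X] [MeasurableSpace Y] {μ : Measure X}

omit [BorelSpace X] [MeasurableVAdd₂ ℝ X] in
-- If `T_t x` lies in the good set, a small change of time moves it little, and the test is
-- Lipschitz; otherwise the trivial bound `1` is charged to the indicator. The set and `δ` do not
-- depend on the test function.
theorem IsAlmostContinuousFlow.exists_abs_eval_sub_le [IsProbabilityMeasure μ]
    (hac : IsAlmostContinuousFlow μ) {η : ℝ} (hη : 0 < η) :
    ∃ A : Set X, MeasurableSet A ∧ μ.real Aᶜ ≤ η ∧ ∃ δ : ℝ, 0 < δ ∧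
      ∀ (f : ProductTest X Y) (s t : ℝ) (z : X × Y), |s - t| ≤ δ →
        |f.eval s z - f.eval t z| ≤ η + Aᶜ.indicator 1 (t +ᵥ z.1) := by
  obtain ⟨A, hA, hmA, h⟩ := hac η hη
  obtain ⟨δ, hδ, h⟩ := h η hη
  refine ⟨A, hA, ?_, δ, hδ, fun f s t z hst => ?_⟩
  · rw [probReal_compl_eq_one_sub hA]
    linarith
  by_cases hz : t +ᵥ z.1 ∈ A
  · have h1 := h _ hz (s - t) (abs_le.1 hst) 0 ⟨by linarith, hδ.le⟩
    rw [vadd_vadd, sub_add_cancel, zero_vadd] at h1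
    have h2 := f.abs_eval_sub_eval_le_dist s t z.1 z.1 z.2
    rw [indicator_of_notMem (by simpa using hz)]
    linarith
  · rw [indicator_of_mem (by simpa using hz), Pi.one_apply]
    linarith [f.abs_eval_sub_eval_le_one s t z z]

variable {ρ : Measure (X × Y)} [IsProbabilityMeasure ρ]

theorem abs_integral_eval_sub_le [VAddInvariantMeasure ℝ X μ] (hρ : ρ.map Prod.fst = μ)
    {A : Set X} (hA : MeasurableSet A) {η : ℝ} (hμA : μ.real Aᶜ ≤ η)
    {f : ProductTest X Y} {s t : ℝ}
    (h : ∀ z, |f.eval s z - f.eval t z| ≤ η + Aᶜ.indicator 1 (t +ᵥ z.1)) :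
    |∫ z, f.eval s z ∂ρ - ∫ z, f.eval t z ∂ρ| ≤ 2 * η := by
  rw [← integral_sub (f.integrable_eval s ρ) (f.integrable_eval t ρ)]
  refine abs_integral_le_integral_abs.trans ?_
  have hi := integrable_indicator_vadd_fst (ρ := ρ) hA.compl t
  calc ∫ z, |f.eval s z - f.eval t z| ∂ρ
      ≤ ∫ z, (η + Aᶜ.indicator (1 : X → ℝ) (t +ᵥ z.1)) ∂ρ :=
        integral_mono ((f.integrable_eval s ρ).sub (f.integrable_eval t ρ)).abs
          ((integrable_const η).add hi) h
    _ = η + μ.real Aᶜ := by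
        rw [integral_add (integrable_const η) hi, integral_indicator_vadd_fst hρ hA.compl]
        simp
    _ ≤ 2 * η := by linarith

theorem continuous_integral_eval [IsProbabilityMeasure μ] [VAddInvariantMeasure ℝ X μ]
    (hac : IsAlmostContinuousFlow μ) (hρ : ρ.map Prod.fst = μ) (f : ProductTest X Y) :
    Continuous fun s => ∫ z, f.eval s z ∂ρ := by
  rw [Metric.continuous_iff]
  intro t ε hε
  obtain ⟨A, hA, hμA, δ, hδ, h⟩ := hac.exists_abs_eval_sub_le (Y := Y) (by positivity : 0 < ε / 3)
  refine ⟨δ, hδ, fun s hs => ?_⟩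
  have := abs_integral_eval_sub_le hρ hA hμA fun z => h f s t z hs.le
  rw [Real.dist_eq]
  linarith

theorem birkhoffAverage_mono {Z : Type*} {T : Z → Z} {f g : Z → ℝ} (h : ∀ z, f z ≤ g z) (n : ℕ)
    (z : Z) : birkhoffAverage ℝ T f n z ≤ birkhoffAverage ℝ T g n z := by
  simp only [birkhoffAverage, birkhoffSum, smul_eq_mul]
  gcongr
  exact h _

theorem abs_birkhoffAverage_sub_le {Z : Type*} {T : Z → Z} {f g h : Z → ℝ} {η : ℝ} (hη : 0 ≤ η)
    (hfg : ∀ z, |f z - g z| ≤ η + h z) (n : ℕ) (z : Z) :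
    |birkhoffAverage ℝ T f n z - birkhoffAverage ℝ T g n z| ≤ η + birkhoffAverage ℝ T h n z := by
  have h1 : birkhoffAverage ℝ T (fun _ => η) n z ≤ η := by
    simp only [birkhoffAverage, birkhoffSum, smul_eq_mul, Finset.sum_const, Finset.card_range,
      nsmul_eq_mul]
    rcases n.eq_zero_or_pos with rfl | hn
    · simpa using hη
    · rw [inv_mul_cancel_left₀ (by positivity)]
  have h2 := birkhoffAverage_mono (T := T) (f := f) (g := g + ((fun _ => η) + h)) (fun z => by
    have := (abs_le.1 (hfg z)).2
    simp only [Pi.add_apply]; linarith) n z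
  have h3 := birkhoffAverage_mono (T := T) (f := g) (g := f + ((fun _ => η) + h)) (fun z => by
    have := (abs_le.1 (hfg z)).1
    simp only [Pi.add_apply]; linarith) n z
  simp only [birkhoffAverage_add, Pi.add_apply] at h2 h3
  rw [abs_le]
  constructor <;> linarith

variable [IsProbabilityMeasure μ] [VAddInvariantMeasure ℝ X μ]

/-- The pointwise ergodic theorem for the functions `f.eval s`, uniformly over points in a large
set, over `s` in a compact set and over finitely many test functions `f`. -/
theorem exists_birkhoffAverage_eval_uniform
    (hac : IsAlmostContinuousFlow μ) (hρ : ρ.map Prod.fst = μ)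
    {R : X × Y → X × Y} (hR : Ergodic R ρ) {Q : Set ℝ} (hQ : IsCompact Q)
    {F : Set (ProductTest X Y)} (hF : F.Finite) {η : ℝ} (hη : 0 < η) {ε : ℝ} (hε : 0 < ε) :
    ∃ (N : ℕ) (G : Set (X × Y)), MeasurableSet G ∧ 1 - ε ≤ ρ.real G ∧
      ∀ z ∈ G, ∀ n ≥ N, ∀ f ∈ F, ∀ s ∈ Q,
        |birkhoffAverage ℝ R (f.eval s) n z - ∫ w, f.eval s w ∂ρ| ≤ η := by
  obtain ⟨A, hA, hμA, δ, hδ, h⟩ := hac.exists_abs_eval_sub_le (Y := Y) (by positivity : 0 < η / 6)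
  -- A finite `δ`-net of shifts reduces the claim to finitely many averages, together with the
  -- frequencies of visits to `Aᶜ` that control passage to the net.
  obtain ⟨t, htQ, htf, ht⟩ := hQ.finite_cover_balls hδ
  lift t to Finset ℝ using htf
  lift F to Finset (ProductTest X Y) using hF
  obtain ⟨N₁, G₁, hG₁, hmG₁, h₁⟩ := exists_birkhoffAverage_uniform_of_finset hR (F ×ˢ t)
    (fun i => i.1.eval i.2) (fun i => i.1.measurable_eval i.2) (fun i => i.1.integrable_eval i.2 ρ)
    (by positivity : 0 < η / 6) (half_pos hε)
  obtain ⟨N₂, G₂, hG₂, hmG₂, h₂⟩ := exists_birkhoffAverage_uniform_of_finset hR t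
    (fun s (z : X × Y) => Aᶜ.indicator (1 : X → ℝ) (s +ᵥ z.1))
    (fun s => (measurable_one.indicator hA.compl).comp (measurable_fst.const_vadd s))
    (fun s => integrable_indicator_vadd_fst hA.compl s) (by positivity : 0 < η / 6) (half_pos hε)
  refine ⟨max N₁ N₂, G₁ ∩ G₂, hG₁.inter hG₂, ?_, ?_⟩
  · have h3 := measureReal_union_add_inter (μ := ρ) (s := G₁) hG₂
    have h4 : ρ.real (G₁ ∪ G₂) ≤ 1 := measureReal_le_one
    linarith
  · intro z hz n hn f hf s hs
    obtain ⟨r, hr, hsr⟩ := mem_iUnion₂.1 (ht hs)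
    have hclose : ∀ z, |f.eval s z - f.eval r z| ≤ η / 6 + Aᶜ.indicator 1 (r +ᵥ z.1) :=
      fun z => h f s r z (le_of_lt hsr)
    have e1 := h₁ z hz.1 n ((le_max_left _ _).trans hn) (f, r)
      (Finset.mk_mem_product hf hr)
    have e2 := h₂ z hz.2 n ((le_max_right _ _).trans hn) r hr
    rw [integral_indicator_vadd_fst hρ hA.compl] at e2
    have e3 := abs_integral_eval_sub_le hρ hA hμA hclose
    have e4 := abs_birkhoffAverage_sub_le (T := R) (by positivity) hclose n z
    -- In units of `η / 6`: one for the average at `r`, two for the integrals, and three for the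
    -- change of averages, of which two bound the frequency of visits to `Aᶜ`.
    rw [abs_le] at e1 e2 e3 e4 ⊢
    dsimp only at e1 e2
    constructor <;> linarith [e1.1, e1.2, e2.1, e2.2, e3.1, e3.2, e4.1, e4.2]

theorem ae_eventually_birkhoffAverage_eval
    (hac : IsAlmostContinuousFlow μ) (hρ : ρ.map Prod.fst = μ)
    {R : X × Y → X × Y} (hR : Ergodic R ρ) {Q : Set ℝ} (hQ : IsCompact Q)
    {F : Set (ProductTest X Y)} (hF : F.Finite) {η : ℝ} (hη : 0 < η) :
    ∀ᵐ z ∂ρ, ∃ N : ℕ, ∀ n ≥ N, ∀ f ∈ F, ∀ s ∈ Q,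
        |birkhoffAverage ℝ R (f.eval s) n z - ∫ w, f.eval s w ∂ρ| ≤ η := by
  choose N G hG hmG h using fun k : ℕ => exists_birkhoffAverage_eval_uniform hac hρ hR hQ hF hη
    (Nat.one_div_pos_of_nat (α := ℝ) (n := k))
  have hU : ρ (⋃ k, G k)ᶜ = 0 := by
    have hm : MeasurableSet (⋃ k, G k) := .iUnion hG
    rw [← measureReal_eq_zero_iff, probReal_compl_eq_one_sub hm, sub_eq_zero]
    refine le_antisymm (le_of_forall_pos_lt_add fun ε hε => ?_) measureReal_le_one
    obtain ⟨k, hk⟩ := exists_nat_one_div_lt hε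
    have := measureReal_mono (μ := ρ) (subset_iUnion G k)
    linarith [hmG k]
  filter_upwards [compl_mem_ae_iff.2 hU] with z hz
  rw [compl_compl] at hz
  obtain ⟨k, hk⟩ := mem_iUnion.1 hz
  exact ⟨N k, h k z hk⟩

end AlmostContinuous

/-- Thickened indicators of closed sets, scaled by their width `d ≤ 1`, are admissible tests;
letting `d` tend to `0` recovers the measures of closed sets, which form a generating π-system. -/
theorem ext_of_forall_lipschitzWith_one_integral_eq {X : Type*} [MetricSpace X] [MeasurableSpace X]
    [BorelSpace X] {P P' : Measure X} [IsFiniteMeasure P] [IsFiniteMeasure P']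
    (h : ∀ φ : X → ℝ, LipschitzWith 1 φ → (∀ x, 0 ≤ φ x) → (∀ x, φ x ≤ 1) →
      ∫ x, φ x ∂P = ∫ x, φ x ∂P') : P = P' := by
  have hδ : ∀ n : ℕ, (0 : ℝ) < 1 / (n + 1 : ℝ) := fun n => Nat.one_div_pos_of_nat
  have hclosed : ∀ F : Set X, IsClosed F → P F = P' F := by
    intro F hF
    have h1 := tendsto_integral_thickenedIndicator_of_isClosed P hF hδ
      tendsto_one_div_add_atTop_nhds_zero_nat
    have h2 := tendsto_integral_thickenedIndicator_of_isClosed P' hF hδ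
      tendsto_one_div_add_atTop_nhds_zero_nat
    have heq : ∀ n : ℕ, ∫ x, (thickenedIndicator (hδ n) F x : ℝ) ∂P =
        ∫ x, (thickenedIndicator (hδ n) F x : ℝ) ∂P' := by
      intro n
      set d : ℝ := 1 / (n + 1 : ℝ) with hd
      have hd1 : d ≤ 1 := by
        rw [hd, div_le_one (by positivity)]
        linarith [n.cast_nonneg (α := ℝ)]
      have h01 : ∀ x, (thickenedIndicator (hδ n) F x : ℝ) ≤ 1 := fun x =>
        NNReal.coe_le_one.2 (thickenedIndicator_le_one (hδ n) F x)
      have hint := h (fun x => d * (thickenedIndicator (hδ n) F x : ℝ)) (by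
        refine LipschitzWith.of_dist_le_mul fun x y => ?_
        have hl := (lipschitzWith_thickenedIndicator (hδ n) F).dist_le_mul x y
        rw [NNReal.dist_eq] at hl
        rw [Real.dist_eq, ← mul_sub, abs_mul, abs_of_pos (hδ n)]
        calc d * |(thickenedIndicator (hδ n) F x : ℝ) - thickenedIndicator (hδ n) F y|
            ≤ d * (((d.toNNReal)⁻¹ : ℝ≥0) * dist x y) := mul_le_mul_of_nonneg_left hl (hδ n).le
          _ = ((1 : ℝ≥0) : ℝ) * dist x y := by
            rw [NNReal.coe_inv, Real.coe_toNNReal d (hδ n).le, mul_inv_cancel_left₀ (hδ n).ne']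
            simp) (fun x => mul_nonneg (hδ n).le (NNReal.coe_nonneg _))
        (fun x => mul_le_one₀ hd1 (NNReal.coe_nonneg _) (h01 x))
      rw [integral_const_mul, integral_const_mul] at hint
      exact mul_left_cancel₀ (hδ n).ne' hint
    simp_rw [heq] at h1
    exact (measureReal_eq_measureReal_iff).1 (tendsto_nhds_unique h1 h2)
  refine ext_of_generate_finite {F : Set X | IsClosed F} ?_ isPiSystem_isClosed hclosed
    (hclosed _ isClosed_univ)
  rw [BorelSpace.measurable_eq (α := X), borel_eq_generateFrom_isClosed]

/-! ### Separating a non-product joining from its shifts -/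

section Separation

variable {X Y : Type*} [MetricSpace X] [MeasurableSpace X] [BorelSpace X] [AddAction ℝ X]
  [MeasurableVAdd₂ ℝ X] [MeasurableSpace Y] {μ : Measure X} {ν : Measure Y}
  {ρ : Measure (X × Y)} [IsProbabilityMeasure ρ] [IsProbabilityMeasure μ]

/-- The hypothesis makes each slice measure `mB` invariant under `T_p`. Being absolutely continuous
with respect to the ergodic `μ`, it is a multiple of `μ`, and its total mass `ν B` fixes the factor.
-/
theorem eq_prod_of_integral_eval_eq (hμ : ρ.map Prod.fst = μ) (hν : ρ.map Prod.snd = ν) {p : ℝ}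
    (hp : Ergodic (p +ᵥ · : X → X) μ)
    (h : ∀ f : ProductTest X Y, ∫ z, f.eval p z ∂ρ = ∫ z, f.eval 0 z ∂ρ) : ρ = μ.prod ν := by
  have hνp : IsProbabilityMeasure ν := hν ▸ Measure.isProbabilityMeasure_map (by fun_prop)
  refine (Measure.prod_eq fun A B hA hB => ?_).symm
  let mB : Measure X := (ρ.restrict (Prod.snd ⁻¹' B)).map Prod.fst
  have hBm : MeasurableSet (Prod.snd ⁻¹' B : Set (X × Y)) := measurable_snd hB
  have hmB : ∀ C, MeasurableSet C → mB C = ρ (C ×ˢ B) := by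
    intro C hC
    rw [Measure.map_apply measurable_fst hC, Measure.restrict_apply (measurable_fst hC)]
    rfl
  have hac : mB ≪ μ := by
    have := Measure.absolutelyContinuous_of_le
      (Measure.restrict_le_self (μ := ρ) (s := (Prod.snd ⁻¹' B : Set (X × Y))))
    have := this.map (f := Prod.fst) measurable_fst
    rwa [hμ] at this
  have hint : ∀ ψ : X → ℝ, Measurable ψ → ∫ x, ψ x ∂mB = ∫ z in Prod.snd ⁻¹' B, ψ z.1 ∂ρ :=
    fun ψ hψ => integral_map measurable_fst.aemeasurable hψ.aestronglyMeasurable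
  have hpres : MeasurePreserving (p +ᵥ · : X → X) mB mB := by
    refine ⟨measurable_const_vadd p, ?_⟩
    refine ext_of_forall_lipschitzWith_one_integral_eq fun φ hφ h0 h1 => ?_
    have hφm := hφ.continuous.measurable
    rw [integral_map (measurable_const_vadd p).aemeasurable hφm.aestronglyMeasurable,
      hint (fun x => φ (p +ᵥ x)) (hφm.comp (measurable_const_vadd p)), hint φ hφm,
      ← integral_indicator hBm, ← integral_indicator hBm]
    have := h ⟨φ, B, hφ, h0, h1, hB⟩
    have e0 : (ProductTest.mk φ B hφ h0 h1 hB).eval 0 =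
        (Prod.snd ⁻¹' B).indicator fun z : X × Y => φ z.1 := by
      ext z
      simp only [ProductTest.eval, zero_vadd]
      rfl
    rw [e0] at this
    exact this
  obtain ⟨c, hc⟩ := hp.eq_smul_of_absolutelyContinuous hpres hac
  have hcB : c = ν B := by
    have h1 := hmB univ .univ
    rw [hc, univ_prod, ← Measure.map_apply measurable_snd hB, hν] at h1
    simpa using h1
  rw [← hmB A hA, hc, hcB, Measure.smul_apply, smul_eq_mul, mul_comm]

theorem exists_finite_productTest_separating [VAddInvariantMeasure ℝ X μ]
    (hac : IsAlmostContinuousFlow μ) (hμ : ρ.map Prod.fst = μ) (hν : ρ.map Prod.snd = ν)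
    (hne : ρ ≠ μ.prod ν) (herg : ∀ p : ℝ, p ≠ 0 → Ergodic (p +ᵥ · : X → X) μ)
    {Q : Set ℝ} (hQ : IsCompact Q) (h0 : (0 : ℝ) ∉ Q) :
    ∃ F : Set (ProductTest X Y), F.Finite ∧ ∃ c : ℝ, 0 < c ∧ ∀ s ∈ Q, ∃ f ∈ F,
      c ≤ |∫ z, f.eval s z ∂ρ - ∫ z, f.eval 0 z ∂ρ| := by
  refine hQ.induction_on (p := fun Q => ∃ F : Set (ProductTest X Y), F.Finite ∧ ∃ c : ℝ, 0 < c ∧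
    ∀ s ∈ Q, ∃ f ∈ F, c ≤ |∫ z, f.eval s z ∂ρ - ∫ z, f.eval 0 z ∂ρ|) ?_ ?_ ?_ ?_
  · exact ⟨∅, finite_empty, 1, one_pos, by simp⟩
  · rintro S T hST ⟨F, hF, c, hc, h⟩
    exact ⟨F, hF, c, hc, fun s hs => h s (hST hs)⟩
  · rintro S T ⟨F, hF, c, hc, h⟩ ⟨F', hF', c', hc', h'⟩
    refine ⟨F ∪ F', hF.union hF', min c c', lt_min hc hc', ?_⟩
    rintro s (hs | hs)
    · obtain ⟨f, hf, hcf⟩ := h s hs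
      exact ⟨f, Or.inl hf, (min_le_left _ _).trans hcf⟩
    · obtain ⟨f, hf, hcf⟩ := h' s hs
      exact ⟨f, Or.inr hf, (min_le_right _ _).trans hcf⟩
  · intro p hpQ
    have hp : p ≠ 0 := fun h => h0 (h ▸ hpQ)
    obtain ⟨f, hf⟩ : ∃ f : ProductTest X Y, ∫ z, f.eval p z ∂ρ ≠ ∫ z, f.eval 0 z ∂ρ := by
      by_contra! h
      exact hne (eq_prod_of_integral_eval_eq hμ hν (herg p hp) h)
    have hpos : 0 < |∫ z, f.eval p z ∂ρ - ∫ z, f.eval 0 z ∂ρ| := abs_pos.2 (sub_ne_zero.2 hf)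
    have hcont : Continuous fun s => |∫ z, f.eval s z ∂ρ - ∫ z, f.eval 0 z ∂ρ| :=
      ((continuous_integral_eval hac hμ f).sub continuous_const).abs
    refine ⟨_, mem_nhdsWithin_of_mem_nhds
      (hcont.continuousAt.eventually (lt_mem_nhds (half_lt_self hpos))),
      {f}, finite_singleton f, _, half_pos hpos, fun s hs => ⟨f, rfl, le_of_lt hs⟩⟩

end Separation

/-! ### Comparing averages at two points of one fibre -/

section GenericPoints

variable {X Y : Type*} [MetricSpace X] [MeasurableSpace Y] [AddAction ℝ X] [AddAction ℝ Y]

theorem ProductTest.eval_iterate_vadd_fst (f : ProductTest X Y) (σ s t : ℝ) (k : ℕ) (x : X)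
    (y : Y) : f.eval t ((σ +ᵥ · : X × Y → X × Y)^[k] (s +ᵥ x, y)) =
      f.eval (t + s) ((σ +ᵥ · : X × Y → X × Y)^[k] (x, y)) := by
  simp only [vadd_iterate, ProductTest.eval, Prod.vadd_mk, vadd_vadd]
  congr 3
  ring_nf

theorem ProductTest.birkhoffAverage_eval_vadd_fst (f : ProductTest X Y) (σ s t : ℝ) (n : ℕ) (x : X)
    (y : Y) : birkhoffAverage ℝ (σ +ᵥ · : X × Y → X × Y) (f.eval t) n (s +ᵥ x, y) =
      birkhoffAverage ℝ (σ +ᵥ · : X × Y → X × Y) (f.eval (t + s)) n (x, y) := by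
  simp only [birkhoffAverage, birkhoffSum, f.eval_iterate_vadd_fst]

theorem ProductTest.abs_birkhoffSum_sub_le (f : ProductTest X Y) {σ s α η : ℝ} {n : ℕ}
    (hn : 0 < n) {z : X × Y}
    (h : |birkhoffAverage ℝ (σ +ᵥ · : X × Y → X × Y) (f.eval s) n z - α| ≤ η) :
    |∑ k ∈ Finset.range n, f.eval s (((k : ℝ) * σ) +ᵥ z) - n * α| ≤ η * n := by
  have hn' : (0 : ℝ) < n := Nat.cast_pos.2 hn
  have h1 : ∑ k ∈ Finset.range n, f.eval s (((k : ℝ) * σ) +ᵥ z) =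
      n * birkhoffAverage ℝ (σ +ᵥ · : X × Y → X × Y) (f.eval s) n z := by
    simp only [birkhoffAverage, birkhoffSum, smul_eq_mul, vadd_iterate, nsmul_eq_mul]
    rw [mul_inv_cancel_left₀ hn'.ne']
  rw [h1, ← mul_sub, abs_mul, abs_of_pos hn', mul_comm]
  exact mul_le_mul_of_nonneg_right h hn'.le

/-- If `x` and a time shift of `y` are close along most of a window `[M, M + L]`, and the ergodic
averages of a test function at both points are close to `α` and `β`, then `α` and `β` are close. -/
theorem ProductTest.abs_sub_le_of_shiftedCloseness (f : ProductTest X Y) {σ p α β η ε κ : ℝ}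
    {N M L : ℕ} {x x' : X} {y : Y} (hη : 0 ≤ η) (hε : 0 ≤ ε) (hκ : 0 < κ)
    (hα : ∀ n ≥ N, |birkhoffAverage ℝ (σ +ᵥ · : X × Y → X × Y) (f.eval 0) n (x, y) - α| ≤ η)
    (hβ : ∀ n ≥ N, |birkhoffAverage ℝ (σ +ᵥ · : X × Y → X × Y) (f.eval p) n (x', y) - β| ≤ η)
    (hM : N < M) (hLM : κ ≤ (L : ℝ) / M) (hclose : 1 - ε < shiftedCloseness σ p ε x x' M L) :
    |α - β| ≤ 2 * η * (2 / κ + 1) + 2 * ε + 1 / (L + 1 : ℝ) := by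
  classical
  set a : ℕ → ℝ := fun n => f.eval 0 (((n : ℝ) * σ) +ᵥ (x, y)) with ha
  set b : ℕ → ℝ := fun n => f.eval p (((n : ℝ) * σ) +ᵥ (x', y)) with hb
  have hM0 : (0 : ℝ) < M := Nat.cast_pos.2 (by omega)
  have hL0 : (0 : ℝ) < L := by
    have : 0 < (L : ℝ) / M := hκ.trans_le hLM
    exact (div_pos_iff_of_pos_right hM0).1 this
  have ha1 := f.abs_birkhoffSum_sub_le (by omega : 0 < M) (hα M hM.le)
  have ha2 := f.abs_birkhoffSum_sub_le (by omega : 0 < M + L + 1) (hα (M + L + 1) (by omega))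
  have hb1 := f.abs_birkhoffSum_sub_le (by omega : 0 < M) (hβ M hM.le)
  have hb2 := f.abs_birkhoffSum_sub_le (by omega : 0 < M + L + 1) (hβ (M + L + 1) (by omega))
  -- The window has `L + 1` points while closeness is normalised by `L`; this mismatch produces the
  -- term `1 / (L + 1)`.
  have hIcc : Finset.Icc M (M + L) = Finset.Ico M (M + L + 1) := by
    ext; simp only [Finset.mem_Icc, Finset.mem_Ico]; omega
  have hsa : ∑ n ∈ Finset.Icc M (M + L), a n =
      ∑ n ∈ Finset.range (M + L + 1), a n - ∑ n ∈ Finset.range M, a n := by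
    rw [hIcc, Finset.sum_Ico_eq_sub _ (by omega)]
  have hsb : ∑ n ∈ Finset.Icc M (M + L), b n =
      ∑ n ∈ Finset.range (M + L + 1), b n - ∑ n ∈ Finset.range M, b n := by
    rw [hIcc, Finset.sum_Ico_eq_sub _ (by omega)]
  set P : ℕ → Prop := fun n => dist (((n : ℝ) * σ) +ᵥ x) (((n : ℝ) * σ + p) +ᵥ x') < ε with hP
  have hcard : (L : ℝ) * (1 - ε) < ((Finset.Icc M (M + L)).filter P).card := by
    have h1 : shiftedCloseness σ p ε x x' M L =
        (1 / (L : ℝ)) * ((Finset.Icc M (M + L)).filter P).card := by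
      unfold shiftedCloseness
      congr!
    rw [h1, one_div, lt_inv_mul_iff₀ hL0] at hclose
    exact hclose
  have hcard2 : (((Finset.Icc M (M + L)).filter P).card : ℝ) +
      ((Finset.Icc M (M + L)).filter fun n => ¬ P n).card = L + 1 := by
    rw [← Nat.cast_add, Finset.card_filter_add_card_filter_not, Nat.card_Icc]
    push_cast [show M + L + 1 - M = L + 1 by omega]
    ring
  have hterm : ∀ n, |a n - b n| ≤ ε + if ¬ P n then 1 else 0 := by
    intro n
    by_cases hn : P n
    · have h1 := f.abs_eval_sub_eval_le_dist 0 p (((n : ℝ) * σ) +ᵥ x) (((n : ℝ) * σ) +ᵥ x')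
        (((n : ℝ) * σ) +ᵥ y)
      rw [zero_vadd, vadd_vadd, add_comm p] at h1
      simp only [not_true_eq_false, if_false, hn, add_zero]
      exact h1.trans (le_of_lt hn)
    · simp only [hn, not_false_eq_true, if_true]
      have := f.abs_eval_sub_eval_le_one 0 p (((n : ℝ) * σ) +ᵥ (x, y)) (((n : ℝ) * σ) +ᵥ (x', y))
      simp only [ha, hb]
      linarith
  have hdiff : |∑ n ∈ Finset.Icc M (M + L), a n - ∑ n ∈ Finset.Icc M (M + L), b n| ≤
      2 * ε * (L + 1) + 1 := by
    rw [← Finset.sum_sub_distrib]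
    refine (Finset.abs_sum_le_sum_abs _ _).trans ((Finset.sum_le_sum fun n _ => hterm n).trans ?_)
    rw [Finset.sum_add_distrib, Finset.sum_const, Finset.sum_boole, Nat.card_Icc, nsmul_eq_mul]
    push_cast [show M + L + 1 - M = L + 1 by omega]
    nlinarith
  have hML : (M : ℝ) ≤ (L + 1) / κ := by
    rw [le_div_iff₀ hM0] at hLM
    rw [le_div_iff₀ hκ]
    linarith
  -- The window sum is the difference of Birkhoff sums of lengths `M + L + 1` and `M`, so each of
  -- the two functions contributes an error `η * (2 * M + L + 1)`.
  have hmain : (L + 1) * |α - β| ≤ 2 * η * (2 * M + (L + 1)) + (2 * ε * (L + 1) + 1) := by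
    rw [← abs_of_pos (by positivity : (0 : ℝ) < L + 1), ← abs_mul,
      abs_of_pos (by positivity : (0 : ℝ) < L + 1)]
    rw [hsa, hsb] at hdiff
    push_cast at ha2 hb2
    rw [abs_le] at ha1 ha2 hb1 hb2 hdiff ⊢
    constructor <;>
      linarith [ha1.1, ha1.2, ha2.1, ha2.2, hb1.1, hb1.2, hb2.1, hb2.2, hdiff.1, hdiff.2]
  have h2 : 2 * η * (2 * M + (L + 1)) ≤ 2 * η * (2 / κ + 1) * (L + 1) := by
    have : 2 * (M : ℝ) + (L + 1) ≤ (2 / κ + 1) * (L + 1) := by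
      calc 2 * (M : ℝ) + (L + 1) ≤ 2 * ((L + 1) / κ) + (L + 1) := by linarith
        _ = (2 / κ + 1) * (L + 1) := by ring
    calc 2 * η * (2 * M + (L + 1)) ≤ 2 * η * ((2 / κ + 1) * (L + 1)) :=
          mul_le_mul_of_nonneg_left this (by positivity)
      _ = _ := by ring
  have hL1 : (0 : ℝ) < L + 1 := by positivity
  refine le_of_mul_le_mul_left ?_ hL1
  calc (L + 1) * |α - β| ≤ _ := hmain
    _ ≤ 2 * η * (2 / κ + 1) * (L + 1) + (2 * ε * (L + 1) + 1) := by linarith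
    _ = (L + 1) * (2 * η * (2 / κ + 1) + 2 * ε + 1 / (L + 1)) := by field_simp; ring

variable [MeasurableSpace X] [BorelSpace X] [MeasurableVAdd₂ ℝ X] [MeasurableVAdd₂ ℝ Y]
  {μ : Measure X} {ν : Measure Y} {ρ : Measure (X × Y)} [IsProbabilityMeasure ρ]
  [IsProbabilityMeasure μ] [VAddInvariantMeasure ℝ X μ]

omit [MeasurableVAdd₂ ℝ Y] in
/-- Almost every fibre of a non-product joining meets each orbit in at most one point. -/
theorem exists_conull_injOn_orbits (hac : IsAlmostContinuousFlow μ) (hμ : ρ.map Prod.fst = μ)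
    (hν : ρ.map Prod.snd = ν) (hne : ρ ≠ μ.prod ν)
    (herg : ∀ p : ℝ, p ≠ 0 → Ergodic (p +ᵥ · : X → X) μ) {σ : ℝ}
    (hσ : Ergodic (σ +ᵥ · : X × Y → X × Y) ρ) :
    ∃ E : Set (X × Y), E ∈ ae ρ ∧ ∀ x x' y, (x, y) ∈ E → (x', y) ∈ E →
      x ∈ AddAction.orbit ℝ x' → x = x' := by
  -- These compact intervals exhaust the positive shifts. If a point and its `s`-shift in the first
  -- coordinate were both generic, the averages of `f.eval s` at the one and `f.eval 0` at the other
  -- would coincide, against the gap on `Q m`.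
  let Q : ℕ → Set ℝ := fun m => Icc (1 / (m + 1 : ℝ)) (m + 1)
  have hQ0 : ∀ m, (0 : ℝ) ∉ Q m := fun m h => by
    have : (0 : ℝ) < 1 / (m + 1 : ℝ) := Nat.one_div_pos_of_nat
    linarith [h.1]
  choose F hF c hc hsep using fun m => exists_finite_productTest_separating hac hμ hν hne herg
    (isCompact_Icc : IsCompact (Q m)) (hQ0 m)
  have hae : ∀ᵐ z ∂ρ, ∀ m, ∃ N : ℕ, ∀ n ≥ N, ∀ f ∈ F m, ∀ s ∈ insert 0 (Q m),
      |birkhoffAverage ℝ (σ +ᵥ · : X × Y → X × Y) (f.eval s) n z - ∫ w, f.eval s w ∂ρ| ≤ c m / 3 :=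
    ae_all_iff.2 fun m => ae_eventually_birkhoffAverage_eval hac hμ hσ (isCompact_Icc.insert 0)
      (hF m) (by have := hc m; positivity)
  have key : ∀ z ∈ {z | ∀ m, ∃ N : ℕ, ∀ n ≥ N, ∀ f ∈ F m, ∀ s ∈ insert 0 (Q m),
      |birkhoffAverage ℝ (σ +ᵥ · : X × Y → X × Y) (f.eval s) n z - ∫ w, f.eval s w ∂ρ| ≤ c m / 3},
      ∀ s : ℝ, 0 < s → (s +ᵥ z.1, z.2) ∉ {z | ∀ m, ∃ N : ℕ, ∀ n ≥ N, ∀ f ∈ F m,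
      ∀ s ∈ insert 0 (Q m), |birkhoffAverage ℝ (σ +ᵥ · : X × Y → X × Y) (f.eval s) n z -
        ∫ w, f.eval s w ∂ρ| ≤ c m / 3} := by
    rintro ⟨x, y⟩ hz s hs hz'
    obtain ⟨m₁, hm₁⟩ := exists_nat_one_div_lt hs
    obtain ⟨m₂, hm₂⟩ := exists_nat_gt s
    set m := max m₁ m₂
    have hsQ : s ∈ Q m := by
      constructor
      · refine le_trans ?_ hm₁.le
        exact one_div_le_one_div_of_le (by positivity)
          (add_le_add (Nat.cast_le.2 (le_max_left m₁ m₂)) le_rfl)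
      · have : (m₂ : ℝ) ≤ m := Nat.cast_le.2 (le_max_right m₁ m₂)
        linarith
    obtain ⟨f, hf, hcf⟩ := hsep m s hsQ
    obtain ⟨N₁, h₁⟩ := hz m
    obtain ⟨N₂, h₂⟩ := hz' m
    have e1 := h₁ (max N₁ N₂) (le_max_left _ _) f hf s (mem_insert_of_mem _ hsQ)
    have e2 := h₂ (max N₁ N₂) (le_max_right _ _) f hf 0 (mem_insert _ _)
    rw [f.birkhoffAverage_eval_vadd_fst, zero_add] at e2
    have hcm := hc m
    rw [abs_sub_comm] at e1
    have := abs_sub_le (∫ w, f.eval s w ∂ρ)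
      (birkhoffAverage ℝ (σ +ᵥ · : X × Y → X × Y) (f.eval s) (max N₁ N₂) (x, y))
      (∫ w, f.eval 0 w ∂ρ)
    linarith
  refine ⟨_, hae, ?_⟩
  rintro x x' y hx hx' ⟨s, rfl⟩
  -- For negative `s` the two points exchange roles.
  rcases lt_trichotomy s 0 with hs | rfl | hs
  · refine absurd ?_ (key _ hx (-s) (neg_pos.2 hs))
    simpa using hx'
  · exact zero_vadd ℝ x'
  · exact absurd hx (key _ hx' s hs)

end GenericPoints

/-! ### Countable fibres from the switchable property -/

section CountableSlices

variable {X Y : Type*} [MetricSpace X] [MeasurableSpace X] [BorelSpace X] [StandardBorelSpace X]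
  [AddAction ℝ X] [MeasurableVAdd₂ ℝ X] [MeasurableSpace Y] [AddAction ℝ Y]
  {μ : Measure X} {ν : Measure Y} {ρ : Measure (X × Y)} [IsProbabilityMeasure ρ]
  [IsProbabilityMeasure μ] [VAddInvariantMeasure ℝ X μ]

theorem exists_pos_measure_countable_slices (hac : IsAlmostContinuousFlow μ)
    (hμ : ρ.map Prod.fst = μ) (hν : ρ.map Prod.snd = ν) (hne : ρ ≠ μ.prod ν)
    (herg : ∀ p : ℝ, p ≠ 0 → Ergodic (p +ᵥ · : X → X) μ) {σ : ℝ}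
    (hσ : Ergodic (σ +ᵥ · : X × Y → X × Y) ρ) (hσ' : Ergodic ((-σ) +ᵥ · : X × Y → X × Y) ρ)
    {P : Set ℝ} (hP : IsCompact P) (hP0 : (0 : ℝ) ∉ P) (hR : HasSwitchableR μ σ P) :
    ∃ W : Set (X × Y), MeasurableSet W ∧ 0 < ρ W ∧ ∀ y, {x | (x, y) ∈ W}.Countable := by
  obtain ⟨F, hF, c, hc, hsep⟩ := exists_finite_productTest_separating hac hμ hν hne herg hP hP0
  obtain ⟨E, hE, horb⟩ := exists_conull_injOn_orbits hac hμ hν hne herg hσ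
  -- With `c / 8`, the term `2 * ε` is at most `c / 4`, as are the other two error terms, for a
  -- total below `c`. With `1 / 4`, discarding the complements of `G₁`, `G₂` and `Z` costs at most
  -- `3 / 4`.
  set ε : ℝ := min (c / 8) (1 / 4) with hεdef
  have hε : 0 < ε := lt_min (by positivity) (by norm_num)
  have hεc : ε ≤ c / 8 := min_le_left _ _
  have hε1 : ε ≤ 1 / 4 := min_le_right _ _
  obtain ⟨κ, hκ, hR⟩ := hR ε hε
  set η : ℝ := c / (8 * (2 / κ + 1)) with hηdef
  have hη : 0 < η := by positivity
  have hη' : 2 * η * (2 / κ + 1) = c / 4 := by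
    rw [hηdef]
    have : 2 / κ + 1 ≠ 0 := by positivity
    generalize 2 / κ + 1 = q at *
    field_simp
    norm_num
  obtain ⟨N₁, G₁, hG₁, hmG₁, h₁⟩ := exists_birkhoffAverage_eval_uniform hac hμ hσ
    (hP.insert 0) hF hη hε
  -- Windows may lie in the past, so averages along `-σ` must be controlled as well.
  obtain ⟨N₂, G₂, hG₂, hmG₂, h₂⟩ := exists_birkhoffAverage_eval_uniform hac hμ hσ'
    (hP.insert 0) hF hη hε
  obtain ⟨N₃, hN₃⟩ := exists_nat_one_div_lt (by positivity : 0 < c / 4)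
  set N := max (max N₁ N₂) N₃
  obtain ⟨δ, hδ, Z, hZ, hmZ, hclose⟩ := hR N
  have hEc : ρ Eᶜ = 0 := hE
  let E' : Set (X × Y) := (toMeasurable ρ Eᶜ)ᶜ
  have hE'm : MeasurableSet E' := (measurableSet_toMeasurable _ _).compl
  have hE'E : E' ⊆ E := compl_subset_comm.1 (subset_toMeasurable ρ Eᶜ)
  have hE'0 : ρ.real E'ᶜ = 0 := by
    rw [compl_compl, measureReal_def, measure_toMeasurable, hEc, ENNReal.toReal_zero]
  have hZm : MeasurableSet (Prod.fst ⁻¹' Z : Set (X × Y)) := measurable_fst hZ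
  refine ⟨G₁ ∩ G₂ ∩ (Prod.fst ⁻¹' Z ∩ E'), (hG₁.inter hG₂).inter (hZm.inter hE'm), ?_, fun y => ?_⟩
  · rw [pos_iff_ne_zero]
    intro h0
    have hW : ρ.real (G₁ ∩ G₂ ∩ (Prod.fst ⁻¹' Z ∩ E'))ᶜ = 1 := by
      rw [probReal_compl_eq_one_sub ((hG₁.inter hG₂).inter (hZm.inter hE'm)), measureReal_def, h0]
      simp
    have hmZ' : ρ.real (Prod.fst ⁻¹' Z : Set (X × Y)) = μ.real Z := by
      rw [← hμ, map_measureReal_apply measurable_fst hZ]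
    simp only [compl_inter] at hW
    have u1 := measureReal_union_le (μ := ρ) (G₁ᶜ ∪ G₂ᶜ) ((Prod.fst ⁻¹' Z)ᶜ ∪ E'ᶜ)
    have u2 := measureReal_union_le (μ := ρ) G₁ᶜ G₂ᶜ
    have u3 := measureReal_union_le (μ := ρ) (Prod.fst ⁻¹' Z)ᶜ E'ᶜ
    rw [probReal_compl_eq_one_sub hG₁, probReal_compl_eq_one_sub hG₂] at u2
    rw [hE'0, probReal_compl_eq_one_sub hZm, hmZ'] at u3
    linarith
  · refine countable_of_separated hδ ?_
    rintro x ⟨⟨hx₁, hx₂⟩, hxZ, hxE⟩ x' ⟨⟨hx'₁, hx'₂⟩, hx'Z, hx'E⟩ hxx'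
    by_contra! hlt
    have hnorb : x ∉ AddAction.orbit ℝ x' := fun h => hxx' (horb x x' y (hE'E hxE) (hE'E hx'E) h)
    obtain ⟨M, L, hM, hL, hκLM, p, hp, hcl⟩ := hclose x hxZ x' hx'Z hlt hnorb
    obtain ⟨f, hf, hcf⟩ := hsep p hp
    have hL' : 1 / (L + 1 : ℝ) ≤ c / 4 := by
      refine le_trans (one_div_le_one_div_of_le (by positivity) ?_) hN₃.le
      have : N₃ ≤ L := (le_max_right _ _).trans hL.le
      exact add_le_add (Nat.cast_le.2 this) le_rfl
    have hle : |∫ w, f.eval 0 w ∂ρ - ∫ w, f.eval p w ∂ρ| ≤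
        2 * η * (2 / κ + 1) + 2 * ε + 1 / (L + 1 : ℝ) := by
      rcases hcl with hcl | hcl
      · exact f.abs_sub_le_of_shiftedCloseness hη.le hε.le hκ
          (fun n hn => h₁ _ hx₁ n hn f hf 0 (mem_insert _ _))
          (fun n hn => h₁ _ hx'₁ n hn f hf p (mem_insert_of_mem _ hp))
          (lt_of_le_of_lt ((le_max_left _ _).trans (le_max_left _ _)) hM) hκLM hcl
      · exact f.abs_sub_le_of_shiftedCloseness hη.le hε.le hκ
          (fun n hn => h₂ _ hx₂ n hn f hf 0 (mem_insert _ _))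
          (fun n hn => h₂ _ hx'₂ n hn f hf p (mem_insert_of_mem _ hp))
          (lt_of_le_of_lt ((le_max_right _ _).trans (le_max_left _ _)) hM) hκLM hcl
    rw [abs_sub_comm] at hle
    linarith

end CountableSlices

/-! ### Atoms of the conditional measures -/

section FibreAtoms

variable {X Y : Type*} [MeasurableSpace X] [StandardBorelSpace X] [MeasurableSpace Y]

theorem measurable_kernel_singleton (κ : ProbabilityTheory.Kernel Y X)
    [ProbabilityTheory.IsSFiniteKernel κ] : Measurable fun q : Y × X => κ q.1 {q.2} := by
  have hS : MeasurableSet {w : (Y × X) × X | w.2 = w.1.2} :=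
    measurableSet_eq_fun measurable_snd (measurable_snd.comp measurable_fst)
  exact ProbabilityTheory.Kernel.measurable_kernel_prodMk_left
    (κ := κ.comap Prod.fst measurable_fst) hS

/-- A probability measure has only finitely many atoms of a given positive mass; here they carry the
full measure `1`. -/
theorem encard_mul_eq_measure {m : Measure X} [IsProbabilityMeasure m] {c : ℝ≥0∞} (hc : c ≠ 0)
    (h : ∀ᵐ x ∂m, m {x} = c) : ∃ n : ℕ, {x | m {x} = c}.encard = n ∧ n * c = 1 := by
  set S := {x | m {x} = c}
  have hfin : S.Finite := by
    by_contra hinf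
    have := Measure.finite_const_le_meas_of_disjoint_iUnion m (pos_iff_ne_zero.2 hc)
      (As := fun x : X => {x}) (fun x => measurableSet_singleton x)
      (fun x y hxy => by simpa [Function.onFun] using hxy)
      (measure_ne_top m _)
    exact hinf (this.subset fun x hx => (le_of_eq (Eq.symm hx) : c ≤ m {x}))
  have hfull : m S = 1 := by
    have : m Sᶜ = 0 := h
    exact (prob_compl_eq_zero_iff hfin.measurableSet).1 this
  refine ⟨S.ncard, (hfin.cast_ncard_eq).symm, ?_⟩
  rw [← hfull, Set.ncard_eq_toFinset_card S hfin]
  have : m S = ∑ x ∈ hfin.toFinset, m {x} := by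
    rw [sum_measure_singleton, hfin.coe_toFinset]
  rw [this, Finset.sum_congr rfl fun x hx => show m {x} = c from hfin.mem_toFinset.1 hx]
  simp

variable [Nonempty X] [AddAction ℝ X] [MeasurableVAdd₂ ℝ X] [AddAction ℝ Y] [MeasurableVAdd₂ ℝ Y]

/-- Transporting the conditional measures by the flow gives another disintegration of the same
invariant measure, so uniqueness applies. The exceptional set of `y` may depend on `t` but not on
`x`. -/
theorem condKernel_vadd_singleton (r : Measure (Y × X)) [IsProbabilityMeasure r]
    [VAddInvariantMeasure ℝ (Y × X) r] [VAddInvariantMeasure ℝ Y r.fst] (t : ℝ) :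
    ∀ᵐ y ∂r.fst, ∀ x, r.condKernel (t +ᵥ y) {t +ᵥ x} = r.condKernel y {x} := by
  let κ := r.condKernel
  let κ' : ProbabilityTheory.Kernel Y X :=
    (κ.comap (t +ᵥ · : Y → Y) (measurable_const_vadd t)).map ((-t) +ᵥ · : X → X)
  have hmap : ∀ y, κ' y = (κ (t +ᵥ y)).map ((-t) +ᵥ · : X → X) := fun y => by
    rw [ProbabilityTheory.Kernel.map_apply _ (measurable_const_vadd (-t)),
      ProbabilityTheory.Kernel.comap_apply]
  have hκ' : r = r.fst ⊗ₘ κ' := by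
    ext S hS
    have hS' : MeasurableSet (((-t) +ᵥ · : Y × X → Y × X) ⁻¹' S) := (measurable_const_vadd (-t)) hS
    rw [Measure.compProd_apply hS]
    have h1 : ∀ y, κ' y (Prod.mk y ⁻¹' S) =
        κ (t +ᵥ y) (Prod.mk (t +ᵥ y) ⁻¹' (((-t) +ᵥ · : Y × X → Y × X) ⁻¹' S)) := by
      intro y
      rw [hmap, Measure.map_apply (measurable_const_vadd (-t)) (measurable_prodMk_left hS)]
      congr 1
      ext x
      simp [vadd_vadd]
    simp_rw [h1]
    rw [(measurePreserving_vadd t r.fst).lintegral_comp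
      (ProbabilityTheory.Kernel.measurable_kernel_prodMk_left (κ := κ) hS'),
      ← Measure.compProd_apply hS', r.disintegrate r.condKernel,
      (measurePreserving_vadd (-t) r).measure_preimage hS.nullMeasurableSet]
  filter_upwards [ProbabilityTheory.eq_condKernel_of_measure_eq_compProd κ' hκ'] with y hy x
  rw [← hy, hmap, Measure.map_apply (measurable_const_vadd (-t)) (measurableSet_singleton x)]
  congr 1
  ext x'
  simp only [mem_singleton_iff, mem_preimage]
  exact ⟨fun h => by simp [h], fun h => by simp [← h]⟩

theorem isFiniteExtension_of_countable_slices {ν : Measure Y} {ρ : Measure (X × Y)}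
    [IsProbabilityMeasure ρ] [VAddInvariantMeasure ℝ (X × Y) ρ] [VAddInvariantMeasure ℝ Y ν]
    (hν : ρ.map Prod.snd = ν) {σ : ℝ} (hσ : Ergodic (σ +ᵥ · : X × Y → X × Y) ρ)
    {W : Set (X × Y)} (hW : MeasurableSet W) (hρW : 0 < ρ W)
    (hWc : ∀ y, {x | (x, y) ∈ W}.Countable) : IsFiniteExtension ν ρ := by
  let r : Measure (Y × X) := ρ.map Prod.swap
  have hr : IsProbabilityMeasure r := Measure.isProbabilityMeasure_map measurable_swap.aemeasurable
  have hrfst : r.fst = ν := by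
    rw [Measure.fst, Measure.map_map measurable_fst measurable_swap, ← hν]
    rfl
  have hrinv : VAddInvariantMeasure ℝ (Y × X) r := by
    refine ⟨fun t S hS => ?_⟩
    rw [Measure.map_apply measurable_swap ((measurable_const_vadd t) hS),
      Measure.map_apply measurable_swap hS]
    exact (measurePreserving_vadd t ρ).measure_preimage (measurable_swap hS).nullMeasurableSet
  have : VAddInvariantMeasure ℝ Y r.fst := hrfst ▸ inferInstance
  have hνp : IsProbabilityMeasure ν := hrfst ▸ inferInstance
  let κ := r.condKernel
  have hdis : ν ⊗ₘ κ = r := by rw [← hrfst]; exact r.disintegrate r.condKernel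
  have hae : ∀ p : X × Y → Prop, (∀ᵐ z ∂ρ, p z) → ∀ᵐ y ∂ν, ∀ᵐ x ∂(κ y), p (x, y) := by
    intro p hp
    have h1 : ∀ᵐ q ∂r, p q.swap := by
      have hsw : MeasurePreserving Prod.swap r ρ := by
        refine ⟨measurable_swap, ?_⟩
        rw [Measure.map_map measurable_swap measurable_swap]
        simp
      exact hsw.quasiMeasurePreserving.ae hp
    rw [← hdis] at h1
    exact Measure.ae_ae_of_ae_compProd h1
  have hae' : ∀ p : X × Y → Prop, (∀ᵐ y ∂ν, ∀ x, p (x, y)) → ∀ᵐ z ∂ρ, p z := by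
    intro p hp
    rw [← hν] at hp
    have := ae_of_ae_map measurable_snd.aemeasurable hp
    filter_upwards [this] with z hz using hz z.1
  let a : X × Y → ℝ≥0∞ := fun z => κ z.2 {z.1}
  have ham : Measurable a := (measurable_kernel_singleton κ).comp measurable_swap
  have hainv : a ∘ (σ +ᵥ · : X × Y → X × Y) =ᵐ[ρ] a := by
    refine hae' (fun z => a (σ +ᵥ z) = a z) ?_
    have := condKernel_vadd_singleton r σ
    rw [hrfst] at this
    exact this
  obtain ⟨c, hc⟩ := hσ.ae_eq_const_of_ae_eq_comp₀ ham.nullMeasurable hainv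
  have hac : ∀ᵐ y ∂ν, ∀ᵐ x ∂(κ y), κ y {x} = c := hae (fun z => a z = c) hc
  -- If `c = 0`, almost every conditional measure would have no atoms, and `W`, with its countable
  -- fibres, would be null.
  have hc0 : c ≠ 0 := by
    rintro rfl
    refine hρW.ne' ?_
    have h1 : r (Prod.swap ⁻¹' W) = ρ W := by
      rw [Measure.map_apply measurable_swap (measurable_swap hW)]
      simp [← preimage_comp]
    rw [← h1, ← hdis, Measure.compProd_apply (measurable_swap hW), lintegral_eq_zero_iff
      (ProbabilityTheory.Kernel.measurable_kernel_prodMk_left (measurable_swap hW))]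
    filter_upwards [hac] with y hy
    have hcnt : (Prod.mk y ⁻¹' (Prod.swap ⁻¹' W)).Countable := hWc y
    refine measure_mono_null (t := {x | ¬ κ y {x} = 0} ∪
      {x | x ∈ Prod.mk y ⁻¹' (Prod.swap ⁻¹' W) ∧ κ y {x} = 0}) ?_ ?_
    · intro x hx
      by_cases h : κ y {x} = 0
      · exact Or.inr ⟨hx, h⟩
      · exact Or.inl h
    · refine measure_union_null hy ?_
      have hcnt' : {x | x ∈ Prod.mk y ⁻¹' (Prod.swap ⁻¹' W) ∧ κ y {x} = 0}.Countable :=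
        hcnt.mono fun x hx => hx.1
      rw [← biUnion_of_singleton {x | x ∈ Prod.mk y ⁻¹' (Prod.swap ⁻¹' W) ∧ κ y {x} = 0},
        measure_biUnion_null_iff hcnt']
      exact fun x hx => hx.2
  have hfib : ∀ᵐ y ∂ν, ∃ n : ℕ, {x | κ y {x} = c}.encard = n ∧ n * c = 1 := by
    filter_upwards [hac] with y hy using encard_mul_eq_measure hc0 hy
  -- The cardinality found over one `y₀` is valid almost everywhere, because `n * c = 1` determines
  -- `n`.
  obtain ⟨y₀, k, -, hk⟩ := hfib.exists
  refine ⟨k, Nat.pos_of_ne_zero fun h => by simp [h] at hk, {z | a z = c},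
    ham (measurableSet_singleton c), hc, ?_⟩
  filter_upwards [hfib] with y ⟨n, hn, hnc⟩
  have hct : c ≠ ∞ := by
    rintro rfl
    rcases k with _ | k <;> simp [ENNReal.mul_top] at hk
  have hkn : n = k := by
    have := (ENNReal.mul_left_inj hc0 hct).1 (hnc.trans hk.symm)
    exact_mod_cast this
  rw [← hkn]
  exact hn

end FibreAtoms

end Preliminaries

theorem theorem2p2
    {X : Type*} [MetricSpace X] [CompleteSpace X] [MeasurableSpace X] [BorelSpace X]
    [StandardBorelSpace X] [AddAction ℝ X] [MeasurableVAdd₂ ℝ X]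
    (μ : Measure X) [IsProbabilityMeasure μ]
    (hwm : IsWeaklyMixingFlow μ) (hac : IsAlmostContinuousFlow μ) (hswr : HasSWR μ)
    {Y : Type*} [MeasurableSpace Y] [StandardBorelSpace Y] [AddAction ℝ Y] [MeasurableVAdd₂ ℝ Y]
    (ν : Measure Y) [IsProbabilityMeasure ν] [ErgodicVAdd ℝ Y ν]
    (ρ : Measure (X × Y)) (hρ : IsErgodicJoining μ ν ρ) :
    ρ = μ.prod ν ∨ IsFiniteExtension ν ρ := by
  refine or_iff_not_imp_left.2 fun hne => ?_
  have := hwm.1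
  have := hρ.ergodic
  have hρp : IsProbabilityMeasure ρ :=
    ⟨by rw [← Set.preimage_univ (f := Prod.fst), ← Measure.map_apply measurable_fst .univ,
      hρ.map_fst, measure_univ]⟩
  have : Nonempty X := μ.nonempty_of_neZero
  have herg : ∀ p : ℝ, p ≠ 0 → Ergodic (p +ᵥ · : X → X) μ := fun p hp => hwm.ergodic_vadd hp
  obtain ⟨P, hP, hP0, hunc⟩ := hswr
  -- Uncountability enters only here: the admissible times cannot all be among the countably many
  -- non-ergodic times of `ρ`.
  obtain ⟨σ, ⟨hσ0, hσR⟩, hσ⟩ : ∃ σ, (0 < σ ∧ HasSwitchableR μ σ P) ∧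
      Ergodic (σ +ᵥ · : X × Y → X × Y) ρ := by
    by_contra! h
    refine hunc ((countable_setOf_not_ergodic_vadd ρ).mono ?_)
    intro σ hσ
    exact ⟨hσ.1, h σ hσ⟩
  obtain ⟨W, hW, hρW, hWc⟩ := exists_pos_measure_countable_slices hac hρ.map_fst hρ.map_snd hne
    herg hσ hσ.neg_vadd hP hP0 hσR
  exact isFiniteExtension_of_countable_slices hρ.map_snd hσ hW hρW hWc
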